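/- Let $n\ge 5$. A real symmetric $n\times n$ matrix $A$ is \emph{copositive} if $x^TAx\ge 0$ for all $x\in\mathbb R^n_+$, and \emph{exceptional} if it is copositive but is not the sum of a positive semi-definite matrix and a symmetric element-wise nonnegative matrix. A copositive $A\neq 0$ is \emph{extremal} if $A=B+C$ with $B,C$ copositive implies that $B$ and $C$ are nonnegative multiples of $A$. A \emph{zero} of a copositive $A$ is a non-zero $v\in\mathbb R_+^n$ with $v^TAv=0$; its support is the set of indices of its positive entries; it is \emph{minimal} if no zero of $A$ has strictly smaller support. Reading indices modulo $n$, let $I_j=(j,j+1,\dots,j+n-3)$ for $j=1,\dots,n$, and let $A_{I_j}$ denote the corresponding principal submatrix. An exceptional $A$ that has zeros $v^1,\dots,v^n$ with $\operatorname{supp}v^j=I_j$ has \emph{minimal circulant zero support set} if every zero of $A$ is proportional to one of the $v^j$, and \emph{non-minimal circulant zero support set} otherwise. Fix ${\bf u}=\{u^1,\dots,u^n\}\subset\mathbb R^n_+$ with $\operatorname{supp}u^j=I_j$ for all $j$, and let $F_{\bf u}$ be the set of copositive $A$ with $(u^j)^TAu^j=0$ for all $j$. Put $d=n-3$, and let $\mathcal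 L_{\bf u}$ be the $d$-dimensional space of real sequences $(x_t)_{t\ge1}$ satisfying $\sum_{i=0}^{d}u^t_{t+i}\,x_{t+i}=0$ for all $t\ge 1$ (upper and lower indices of $u$ modulo $n$). Let $\mathfrak M:\mathcal L_{\bf u}\to\mathcal L_{\bf u}$, $(x_t)_t\mapsto(x_{t+n})_t$, be the monodromy operator, and let ${\bf e}_t\in\mathcal L_{\bf u}^*$ be the evaluation $x\mapsto x_t$; then ${\bf e}_1,\dots,{\bf e}_d$ is a basis of $\mathcal L_{\bf u}^*$. Let $\mathcal A_{\bf u}$ be the space of real symmetric matrices $A$ with $A_{I_j}u^j_{I_j}=0$ for all $j$, and for $A\in\mathcal A_{\bf u}$ let $\Lambda(A)$ be the symmetric bilinear form $B$ on $\mathcal L_{\bf u}^*$ with $B({\bf e}_t,{\bf e}_s)=A_{ts}$ for $t,s=1,\dots,d$. Let $A\in F_{\bf u}$ be exceptional. Then $A\in\mathcal A_{\bf u}$ and, with $B=\Lambda(A)$, exactly one of the following two cases (i), (ii) holds, each with all of its assertions. (i) (a) $A$ has minimal circulant zero support set; (b) $B$ is positive definite; (c) $A_{I_j}$ has corank $1$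 for every $j$; (d) the set of supports of minimal zeros of $A$ is $\{I_1,\dots,I_n\}$, and the minimal zeros of $A$ are exactly the positive multiples of $u^1,\dots,u^n$; (e) if $n$ is even, $A$ is the sum of an exceptional copositive matrix with non-minimal circulant zero support set and a positive semi-definite matrix of rank $1$; (f) if $n$ is odd and $-1$ is not an eigenvalue of $\mathfrak M$, then $A$ is extremal. (ii) (a) $A$ has non-minimal circulant zero support set; (b) $B$ has corank $1$; (c) $A_{I_j}$ has corank $2$ for every $j$; (d) the support of every minimal zero of $A$ is a strict subset of some $I_j$, and every $I_j$ has exactly two subsets that are supports of minimal zeros of $A$; (e) every non-minimal zero of $A$ has support equal to some $I_j$ and is a sum of two minimal zeros of $A$; (f) $A$ is extremal. -/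

import Mathlib

open Matrix

/-! Copositive matrices and their zeros. -/

/-- `A` belongs to the cone of real symmetric copositive matrices. -/
def IsCopositive {n : ℕ} (A : Matrix (Fin n) (Fin n) ℝ) : Prop :=
  A.IsSymm ∧ ∀ x : Fin n → ℝ, 0 ≤ x → 0 ≤ x ⬝ᵥ (A *ᵥ x)

/-- A copositive matrix is exceptional if it is not the sum of a positive semi-definite matrix
and a symmetric element-wise nonnegative matrix. -/
def IsExceptional {n : ℕ} (A : Matrix (Fin n) (Fin n) ℝ) : Prop :=
  IsCopositive A ∧
    ¬ ∃ P N : Matrix (Fin n) (Fin n) ℝ,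
      P.PosSemidef ∧ N.IsSymm ∧ (∀ i j, 0 ≤ N i j) ∧ A = P + N

/-- `A` generates an extreme ray of the copositive cone. -/
def IsExtremalCopositive {n : ℕ} (A : Matrix (Fin n) (Fin n) ℝ) : Prop :=
  IsCopositive A ∧ A ≠ 0 ∧
    ∀ B C : Matrix (Fin n) (Fin n) ℝ, IsCopositive B → IsCopositive C → A = B + C →
      ∃ b c : ℝ, 0 ≤ b ∧ 0 ≤ c ∧ B = b • A ∧ C = c • A

/-- `v` is a zero of the copositive matrix `A`.  Since `v` is nonnegative, its support
(the set of its positive entries) is `Function.support v`. -/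
def IsZeroOf {n : ℕ} (A : Matrix (Fin n) (Fin n) ℝ) (v : Fin n → ℝ) : Prop :=
  v ≠ 0 ∧ 0 ≤ v ∧ v ⬝ᵥ (A *ᵥ v) = 0

/-- A zero is minimal if no other zero has strictly smaller support. -/
def IsMinimalZeroOf {n : ℕ} (A : Matrix (Fin n) (Fin n) ℝ) (v : Fin n → ℝ) : Prop :=
  IsZeroOf A v ∧
    ¬ ∃ w : Fin n → ℝ, IsZeroOf A w ∧ Function.support w ⊂ Function.support v

/-- The minimal zero support set of `A`. -/
def minimalZeroSupports {n : ℕ} (A : Matrix (Fin n) (Fin n) ℝ) : Set (Set (Fin n)) :=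
  {S | ∃ v : Fin n → ℝ, IsMinimalZeroOf A v ∧ Function.support v = S}

/-- The corank (dimension of the kernel) of a square matrix. -/
noncomputable def matrixCorank {m : ℕ} (M : Matrix (Fin m) (Fin m) ℝ) : ℕ :=
  Module.finrank ℝ (LinearMap.ker M.mulVecLin)

/-! The circular arcs `I_j` and collections of vectors supported on them.  Indices are counted
from `0`, and are read modulo `n`. -/

/-- The ordered index set `I_j = (j, j + 1, …, j + n - 3)` (indices modulo `n`). -/
def arc (n : ℕ) [NeZero n] (j : Fin n) (i : Fin (n - 2)) : Fin n :=
  Fin.ofNat n ((j : ℕ) + (i : ℕ))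

/-- The index set `I_j` without its order. -/
def arcSet (n : ℕ) [NeZero n] (j : Fin n) : Set (Fin n) :=
  Set.range (arc n j)

/-- The vectors `u^j` are nonnegative with support `I_j`. -/
def HasCirculantSupports {n : ℕ} [NeZero n] (u : Fin n → Fin n → ℝ) : Prop :=
  ∀ j, 0 ≤ u j ∧ Function.support (u j) = arcSet n j

/-- The principal submatrix `A_{I_j}`. -/
def arcSubmatrix {n : ℕ} [NeZero n] (A : Matrix (Fin n) (Fin n) ℝ) (j : Fin n) :
    Matrix (Fin (n - 2)) (Fin (n - 2)) ℝ :=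
  A.submatrix (arc n j) (arc n j)

/-- The face `F_u` of the copositive cone. -/
def copositiveFace {n : ℕ} (u : Fin n → Fin n → ℝ) : Set (Matrix (Fin n) (Fin n) ℝ) :=
  {A | IsCopositive A ∧ ∀ j, u j ⬝ᵥ (A *ᵥ u j) = 0}

/-- `A` is exceptional, has zeros `u^j` with supports `I_j`, and every zero of `A` is
proportional to one of them. -/
def HasMinimalCirculantZeroSupport {n : ℕ} [NeZero n] (A : Matrix (Fin n) (Fin n) ℝ) : Prop :=
  IsExceptional A ∧ ∃ u : Fin n → Fin n → ℝ, HasCirculantSupports u ∧ (∀ j, IsZeroOf A (u j)) ∧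
    ∀ v, IsZeroOf A v → ∃ (j : Fin n) (c : ℝ), v = c • u j

/-- `A` is exceptional, has zeros `u^j` with supports `I_j`, and some zero of `A` is
proportional to none of them. -/
def HasNonMinimalCirculantZeroSupport {n : ℕ} [NeZero n] (A : Matrix (Fin n) (Fin n) ℝ) : Prop :=
  IsExceptional A ∧ ∃ u : Fin n → Fin n → ℝ, HasCirculantSupports u ∧ (∀ j, IsZeroOf A (u j)) ∧
    ¬ ∀ v, IsZeroOf A v → ∃ (j : Fin n) (c : ℝ), v = c • u j

/-! The linear periodic system of order `d = n - 3` and period `n` attached to `u`. -/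

/-- The space of solutions `x = (x_0, x_1, …)` of `∑_{i = 0}^{d} u^t_{t + i} x_{t + i} = 0`,
`t ≥ 0`, where the indices of `u` are read modulo `n`. -/
def solutionSpace {n : ℕ} [NeZero n] (u : Fin n → Fin n → ℝ) : Submodule ℝ (ℕ → ℝ) where
  carrier := {x | ∀ t : ℕ,
    ∑ i : Fin (n - 2), u (Fin.ofNat n t) (arc n (Fin.ofNat n t) i) * x (t + i) = 0}
  add_mem' := by
    intro x y hx hy t
    have h1 := hx t
    have h2 := hy t
    simp only [Pi.add_apply, mul_add, Finset.sum_add_distrib]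
    rw [h1, h2, add_zero]
  zero_mem' := by
    intro t
    simp
  smul_mem' := by
    intro c x hx t
    have h1 := hx t
    simp only [Pi.smul_apply, smul_eq_mul, mul_left_comm _ c, ← Finset.mul_sum]
    rw [h1, mul_zero]

/-- The monodromy operator `(x_t) ↦ (x_{t + n})` on the solution space. -/
def monodromy {n : ℕ} [NeZero n] (u : Fin n → Fin n → ℝ) :
    Module.End ℝ (solutionSpace u) where
  toFun x := ⟨fun t => (x : ℕ → ℝ) (t + n), by
    intro t
    have h := x.2 (t + n)
    have e : Fin.ofNat n (t + n) = Fin.ofNat n t := by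
      apply Fin.ext
      simp [Fin.ofNat]
    rw [e] at h
    rw [← h]
    refine Finset.sum_congr rfl fun i _ => ?_
    change _ * (x : ℕ → ℝ) (t + i + n) = _
    rw [show t + (i : ℕ) + n = t + n + i by omega]⟩
  map_add' _ _ := rfl
  map_smul' _ _ := rfl

/-- The evaluation functional `e_t : x ↦ x_t`. -/
def evalAt {n : ℕ} [NeZero n] (u : Fin n → Fin n → ℝ) (t : ℕ) :
    Module.Dual ℝ (solutionSpace u) :=
  (LinearMap.proj t : (ℕ → ℝ) →ₗ[ℝ] ℝ) ∘ₗ (solutionSpace u).subtype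

/-- The map taking a solution to its initial values `(x_0, …, x_{d - 1})`. -/
def initialValues {n : ℕ} [NeZero n] (u : Fin n → Fin n → ℝ) :
    solutionSpace u →ₗ[ℝ] (Fin (n - 3) → ℝ) :=
  LinearMap.pi fun i => evalAt u i

/-- The sequence with the initial values `a` generated by the recursion. -/
noncomputable def generate {n : ℕ} [NeZero n] (u : Fin n → Fin n → ℝ) (a : Fin (n - 3) → ℝ) :
    ℕ → ℝ
  | t =>
    if h : t < n - 3 then a ⟨t, h⟩
    else
      let j : Fin n := Fin.ofNat n (t - (n - 3))
      (-∑ i : Fin (n - 3), u j (Fin.ofNat n (j + i)) * generate u a (t - (n - 3) + i))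
        / u j (Fin.ofNat n (j + (n - 3)))
  decreasing_by omega

theorem solution_eq_iff {n : ℕ} [NeZero n] (hn : 5 ≤ n) (u : Fin n → Fin n → ℝ) (x : ℕ → ℝ)
    (t : ℕ) :
    (∑ i : Fin (n - 2), u (Fin.ofNat n t) (arc n (Fin.ofNat n t) i) * x (t + i)) =
      (∑ i : Fin (n - 3), u (Fin.ofNat n t) (Fin.ofNat n ((Fin.ofNat n t : Fin n) + i))
        * x (t + i)) +
      u (Fin.ofNat n t) (Fin.ofNat n ((Fin.ofNat n t : Fin n) + (n - 3))) * x (t + (n - 3)) := by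
  have key : ∀ (m : ℕ) (f : ℕ → ℝ), m = (n - 3) + 1 →
      ∑ i : Fin m, f i = (∑ i : Fin (n - 3), f i) + f (n - 3) := by
    intro m f hm
    subst hm
    rw [Fin.sum_univ_castSucc]
    simp
  exact key (n - 2) (fun i => u (Fin.ofNat n t)
    (Fin.ofNat n ((Fin.ofNat n t : Fin n) + i)) * x (t + i)) (by omega)

theorem leading_ne_zero {n : ℕ} [NeZero n] (hn : 5 ≤ n) {u : Fin n → Fin n → ℝ}
    (hu : HasCirculantSupports u) (j : Fin n) : u j (Fin.ofNat n (j + (n - 3))) ≠ 0 := by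
  have h : Fin.ofNat n ((j : ℕ) + (n - 3)) ∈ Function.support (u j) := by
    rw [(hu j).2]
    exact ⟨⟨n - 3, by omega⟩, rfl⟩
  exact h

theorem initialValues_bijective {n : ℕ} [NeZero n] (hn : 5 ≤ n) {u : Fin n → Fin n → ℝ}
    (hu : HasCirculantSupports u) : Function.Bijective (initialValues u) := by
  constructor
  · rw [injective_iff_map_eq_zero]
    intro x hx
    apply Subtype.ext
    funext t
    induction t using Nat.strong_induction_on with
    | _ t ih =>
      by_cases h : t < n - 3
      · exact congrFun hx ⟨t, h⟩
      · have h1 := x.2 (t - (n - 3))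
        rw [solution_eq_iff hn, Finset.sum_eq_zero, zero_add,
          show t - (n - 3) + (n - 3) = t by omega] at h1
        · exact (mul_eq_zero.1 h1).resolve_left (leading_ne_zero hn hu _)
        · intro i _
          rw [ih _ (by omega)]
          simp
  · intro a
    refine ⟨⟨generate u a, ?_⟩, ?_⟩
    · intro t
      rw [solution_eq_iff hn]
      have h1 := generate.eq_def u a (t + (n - 3))
      rw [dif_neg (by omega), show t + (n - 3) - (n - 3) = t by omega] at h1
      rw [h1]
      have h2 := leading_ne_zero hn hu (Fin.ofNat n t)
      dsimp only
      rw [mul_div_cancel₀ _ h2]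
      ring
    · funext i
      change generate u a i = a i
      rw [generate, dif_pos i.2]

/-- The basis of the solution space dual to the evaluation functionals `e_0, …, e_{d - 1}`. -/
noncomputable def solutionBasis {n : ℕ} [NeZero n] (hn : 5 ≤ n) {u : Fin n → Fin n → ℝ}
    (hu : HasCirculantSupports u) : Module.Basis (Fin (n - 3)) ℝ (solutionSpace u) :=
  Module.Basis.ofEquivFun
    (LinearEquiv.ofBijective (initialValues u) (initialValues_bijective hn hu))

/-- The basis `e_0, …, e_{d - 1}` of the dual of the solution space. -/
noncomputable def evalBasis {n : ℕ} [NeZero n] (hn : 5 ≤ n) {u : Fin n → Fin n → ℝ}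
    (hu : HasCirculantSupports u) :
    Module.Basis (Fin (n - 3)) ℝ (Module.Dual ℝ (solutionSpace u)) :=
  (solutionBasis hn hu).dualBasis

theorem evalBasis_apply {n : ℕ} [NeZero n] (hn : 5 ≤ n) {u : Fin n → Fin n → ℝ}
    (hu : HasCirculantSupports u) (t : Fin (n - 3)) : evalBasis hn hu t = evalAt u t := by
  ext x
  simp [evalBasis, solutionBasis, initialValues]

/-! The correspondence between matrices and bilinear forms. -/

/-- The space `𝒜_u` of symmetric matrices with `A_{I_j} u^j_{I_j} = 0` for all `j`. -/
def matrixSpace {n : ℕ} [NeZero n] (u : Fin n → Fin n → ℝ) :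
    Submodule ℝ (Matrix (Fin n) (Fin n) ℝ) where
  carrier := {A | A.IsSymm ∧ ∀ j, arcSubmatrix A j *ᵥ (u j ∘ arc n j) = 0}
  add_mem' := by
    rintro A B ⟨hA, hA'⟩ ⟨hB, hB'⟩
    refine ⟨hA.add hB, fun j => ?_⟩
    have : arcSubmatrix (A + B) j = arcSubmatrix A j + arcSubmatrix B j := rfl
    rw [this, Matrix.add_mulVec, hA' j, hB' j, add_zero]
  zero_mem' := by
    refine ⟨Matrix.isSymm_zero, fun j => ?_⟩
    have : arcSubmatrix (0 : Matrix (Fin n) (Fin n) ℝ) j = 0 := rfl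
    rw [this, Matrix.zero_mulVec]
  smul_mem' := by
    rintro c A ⟨hA, hA'⟩
    refine ⟨hA.smul c, fun j => ?_⟩
    have : arcSubmatrix (c • A) j = c • arcSubmatrix A j := rfl
    rw [this, Matrix.smul_mulVec, hA' j, smul_zero]

/-- The linear map `Λ` taking `A ∈ 𝒜_u` to the bilinear form `B` on the dual of the solution space
with `B(e_t, e_s) = A_{ts}` for `t, s = 0, …, d - 1`. -/
noncomputable def formOfMatrix {n : ℕ} [NeZero n] (hn : 5 ≤ n) {u : Fin n → Fin n → ℝ}
    (hu : HasCirculantSupports u) :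
    matrixSpace u →ₗ[ℝ] LinearMap.BilinForm ℝ (Module.Dual ℝ (solutionSpace u)) where
  toFun A := Matrix.toBilin (evalBasis hn hu)
    ((A : Matrix (Fin n) (Fin n) ℝ).submatrix
      (fun t : Fin (n - 3) => Fin.ofNat n t) (fun t : Fin (n - 3) => Fin.ofNat n t))
  map_add' A B := by
    rw [← map_add]
    rfl
  map_smul' c A := by
    rw [RingHom.id_apply, ← map_smul]
    rfl

theorem formOfMatrix_evalAt {n : ℕ} [NeZero n] (hn : 5 ≤ n) {u : Fin n → Fin n → ℝ}
    (hu : HasCirculantSupports u) (A : matrixSpace u) (t s : Fin (n - 3)) :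
    formOfMatrix hn hu A (evalAt u t) (evalAt u s) =
      (A : Matrix (Fin n) (Fin n) ℝ) (Fin.ofNat n t) (Fin.ofNat n s) := by
  rw [← evalBasis_apply hn hu, ← evalBasis_apply hn hu]
  simp [formOfMatrix, Matrix.toBilin_apply, Finsupp.single_apply]

/-- A positive definite symmetric bilinear form. -/
def IsPosDefForm {V : Type*} [AddCommGroup V] [Module ℝ V] (B : LinearMap.BilinForm ℝ V) : Prop :=
  B.IsSymm ∧ ∀ w : V, w ≠ 0 → 0 < B w w

/-- The corank of a bilinear form: the dimension of `{w | ∀ w', B(w, w') = 0}`. -/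
noncomputable def formCorank {V : Type*} [AddCommGroup V] [Module ℝ V]
    (B : LinearMap.BilinForm ℝ V) : ℕ :=
  Module.finrank ℝ (LinearMap.ker B)

/-! The two cases. -/

/-- The properties of the case of a minimal circulant zero support set. -/
structure MinimalCase {n : ℕ} [NeZero n] (u : Fin n → Fin n → ℝ) (A : Matrix (Fin n) (Fin n) ℝ)
    (B : LinearMap.BilinForm ℝ (Module.Dual ℝ (solutionSpace u))) : Prop where
  minimal_support : HasMinimalCirculantZeroSupport A
  posDef : IsPosDefForm B
  corank_submatrix : ∀ j, matrixCorank (arcSubmatrix A j) = 1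
  minimal_zero_supports : minimalZeroSupports A = Set.range (arcSet n)
  minimal_zeros : ∀ v, IsMinimalZeroOf A v ↔ ∃ (j : Fin n) (c : ℝ), 0 < c ∧ v = c • u j
  even_decomposition : Even n → ∃ A' P : Matrix (Fin n) (Fin n) ℝ,
    HasNonMinimalCirculantZeroSupport A' ∧ P.PosSemidef ∧ P.rank = 1 ∧ A = A' + P
  odd_extremal : Odd n → ¬ (monodromy u).HasEigenvalue (-1) → IsExtremalCopositive A

/-- The properties of the case of a non-minimal circulant zero support set. -/
structure NonMinimalCase {n : ℕ} [NeZero n] (u : Fin n → Fin n → ℝ)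
    (A : Matrix (Fin n) (Fin n) ℝ)
    (B : LinearMap.BilinForm ℝ (Module.Dual ℝ (solutionSpace u))) : Prop where
  nonminimal_support : HasNonMinimalCirculantZeroSupport A
  corank_form : formCorank B = 1
  corank_submatrix : ∀ j, matrixCorank (arcSubmatrix A j) = 2
  minimal_zeros_strict : ∀ v, IsMinimalZeroOf A v → ∃ j, Function.support v ⊂ arcSet n j
  two_minimal_supports : ∀ j, {S ∈ minimalZeroSupports A | S ⊆ arcSet n j}.ncard = 2
  nonminimal_zeros : ∀ v, IsZeroOf A v → ¬ IsMinimalZeroOf A v →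
    (∃ j, Function.support v = arcSet n j) ∧
      ∃ v₁ v₂, IsMinimalZeroOf A v₁ ∧ IsMinimalZeroOf A v₂ ∧ v = v₁ + v₂
  extremal : IsExtremalCopositive A

/-!
Let `B = Λ(A)`. The evaluation functionals satisfy the recurrence defining `solutionSpace u`, and so
does `A` along the arcs; hence `B(e_s, e_t) = A_{s,t}` whenever `s` and `t` lie in a common arc, and
`x ↦ ∑ x_k e_k` carries the quadratic form of `A` on vectors supported on an arc to that of `B`. The
kernel of this map is the line spanned by `u^j`, so the corank of `A_{I_j}` is the corank of `B`
plus one. For a vector `x` supported on two overlapping arcs, `xᵀ A x` is the value of `B` plus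
twice a product of two end entries of `x` times a number that is positive for exceptional `A`. So
the zeros of an exceptional `A` are supported on arcs, the kernel vectors of `A_{I_j}` are
determined by their two end entries, and the corank of `B` is at most one.

If the corank is one, the kernels on the arcs are parametrized by the end entries, and the minimal
zeros are the kernel vectors vanishing at one end. If `q` vanishes at the last index of its arc,
then `A q` is concentrated in a single entry. Hence a copositive summand `X` of `A` satisfies `X q =
c • A q`, with the same `c` for all arcs, and this forces `X = c • A`.

If `B` is positive definite, subtract from `A` the largest admissible multiple of a matrix of the
face. The result is either an exceptional matrix with degenerate form or a positive semidefinite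
matrix with all `u^j` in its kernel. For odd `n` and a degenerate exceptional matrix, the kernel of
the form is spanned by an eigenvector of the dual of the monodromy. Its eigenvalue is `±1`, since
the monodromy preserves the positive definite form, and it is not `+1`, since the coordinates of
this vector in the basis `e_t, …, e_{t+d-1}` have a common sign, which changes when `t` grows by
one. For even `n`, the monodromy is an isometry of `B` of positive determinant on a space of odd
dimension, so it has a fixed vector. It yields a vector `y` orthogonal to all `u^j`, and a multiple
of `y yᵀ` splits off from `A`.
-/

/-! ### Quadratic forms of symmetric matrices -/

section Quadratic

variable {ι : Type*} [Fintype ι]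

theorem dotProduct_mulVec_comm {R : Type*} [CommRing R] {A : Matrix ι ι R} (hA : A.IsSymm)
    (x y : ι → R) : x ⬝ᵥ (A *ᵥ y) = y ⬝ᵥ (A *ᵥ x) := by
  rw [dotProduct_mulVec, ← mulVec_transpose, hA.eq, dotProduct_comm]

theorem dotProduct_mulVec_add_smul {R : Type*} [CommRing R] {A : Matrix ι ι R} (hA : A.IsSymm)
    (x y : ι → R) (t : R) :
    (x + t • y) ⬝ᵥ (A *ᵥ (x + t • y)) =
      x ⬝ᵥ (A *ᵥ x) + t * (2 * y ⬝ᵥ (A *ᵥ x) + t * y ⬝ᵥ (A *ᵥ y)) := by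
  simp only [mulVec_add, mulVec_smul, dotProduct_add, add_dotProduct, dotProduct_smul,
    smul_dotProduct, smul_eq_mul]
  rw [dotProduct_mulVec_comm hA x y]
  ring

theorem nonneg_of_forall_pos_add_mul_nonneg {a b : ℝ} (h : ∀ t : ℝ, 0 < t → 0 ≤ a + t * b) :
    0 ≤ a := by
  have hlim : Filter.Tendsto (fun t : ℝ => a + t * b) (nhdsWithin 0 (Set.Ioi 0)) (nhds a) := by
    have hcont : Continuous fun t : ℝ => a + t * b := by fun_prop
    simpa using (hcont.tendsto 0).mono_left nhdsWithin_le_nhds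
  exact ge_of_tendsto hlim (Filter.eventually_of_mem self_mem_nhdsWithin h)

theorem apply_eq_zero_of_dotProduct_eq_zero {v w : ι → ℝ} (hv : 0 ≤ v) (hw : 0 ≤ w)
    (h : v ⬝ᵥ w = 0) {k : ι} (hk : v k ≠ 0) : w k = 0 := by
  rw [dotProduct, Finset.sum_eq_zero_iff_of_nonneg fun i _ => mul_nonneg (hv i) (hw i)] at h
  exact (mul_eq_zero.1 (h k (Finset.mem_univ k))).resolve_left hk

theorem apply_eq_zero_of_dotProduct_mulVec_eq_zero {N : Matrix ι ι ℝ} (hN : ∀ i j, 0 ≤ N i j)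
    {v : ι → ℝ} (hv : 0 ≤ v) (h : v ⬝ᵥ (N *ᵥ v) = 0) {k l : ι} (hk : v k ≠ 0) (hl : v l ≠ 0) :
    N k l = 0 := by
  have hNv : (N *ᵥ v) k = 0 := apply_eq_zero_of_dotProduct_eq_zero hv
    (fun i => dotProduct_nonneg_of_nonneg (hN i) hv) h hk
  exact apply_eq_zero_of_dotProduct_eq_zero hv (hN k) (by rwa [dotProduct_comm]) hl

theorem posSemidef_of_dotProduct_mulVec_nonneg {A : Matrix ι ι ℝ} (hA : A.IsSymm)
    (h : ∀ x, 0 ≤ x ⬝ᵥ (A *ᵥ x)) : A.PosSemidef :=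
  .of_dotProduct_mulVec_nonneg (isHermitian_iff_isSymm.2 hA) (by simpa using h)

theorem posSemidef_of_mulVec_eq_zero {A : Matrix ι ι ℝ} (hA : A.IsSymm) {v : ι → ℝ}
    (hAv : A *ᵥ v = 0) {m : ι} (hm : v m ≠ 0)
    (hpos : ∀ x : ι → ℝ, x m = 0 → 0 ≤ x ⬝ᵥ (A *ᵥ x)) : A.PosSemidef := by
  refine posSemidef_of_dotProduct_mulVec_nonneg hA fun x => ?_
  have hvA : v ⬝ᵥ (A *ᵥ x) = 0 := by rw [dotProduct_mulVec_comm hA, hAv, dotProduct_zero]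
  have h := hpos (x + (-(x m / v m)) • v) (by simp [hm])
  rwa [dotProduct_mulVec_add_smul hA, hvA, hAv, dotProduct_zero, mul_zero, mul_zero, add_zero,
    mul_zero, add_zero] at h

/-- If `A` is nonnegative on a coordinate hyperplane and has a zero outside of it, then the
negative part of `A` can be cancelled by a nonnegative matrix concentrated in one row and column. -/
theorem exists_posSemidef_add_nonneg {A : Matrix ι ι ℝ} (hA : A.IsSymm) {v : ι → ℝ} (hv : 0 ≤ v)
    (hv0 : v ⬝ᵥ (A *ᵥ v) = 0) (hAv : 0 ≤ A *ᵥ v) {m : ι} (hm : v m ≠ 0)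
    (hpos : ∀ x : ι → ℝ, x m = 0 → 0 ≤ x ⬝ᵥ (A *ᵥ x)) :
    ∃ P N : Matrix ι ι ℝ, P.PosSemidef ∧ N.IsSymm ∧ (∀ i j, 0 ≤ N i j) ∧ A = P + N := by
  classical
  set s : ι → ℝ := (v m)⁻¹ • (A *ᵥ v)
  set e : ι → ℝ := Pi.single m 1
  have hs : 0 ≤ s := smul_nonneg (inv_nonneg.2 (hv m)) hAv
  have he : 0 ≤ e := Pi.single_nonneg.2 zero_le_one
  set N : Matrix ι ι ℝ := vecMulVec s e + vecMulVec e s with hN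
  have hNsymm : N.IsSymm := by
    rw [Matrix.IsSymm, hN, transpose_add, transpose_vecMulVec, transpose_vecMulVec, add_comm]
  have hNmul (x : ι → ℝ) : N *ᵥ x = x m • s + (s ⬝ᵥ x) • e := by
    simp [hN, add_mulVec, vecMulVec_mulVec, e]
  have hsv : s ⬝ᵥ v = 0 := by rw [smul_dotProduct, dotProduct_comm, hv0, smul_zero]
  have hker : (A - N) *ᵥ v = 0 := by
    rw [sub_mulVec, hNmul, hsv, zero_smul, add_zero, smul_inv_smul₀ hm, sub_self]
  refine ⟨A - N, N, posSemidef_of_mulVec_eq_zero (hA.sub hNsymm) hker hm fun x hx => ?_, hNsymm,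
    fun i j => add_nonneg (mul_nonneg (hs i) (he j)) (mul_nonneg (he i) (hs j)),
    (sub_add_cancel A N).symm⟩
  have hxe : x ⬝ᵥ e = 0 := by simp [e, hx]
  rw [sub_mulVec, hNmul, hx, zero_smul, zero_add, dotProduct_sub, dotProduct_smul, hxe, smul_zero,
    sub_zero]
  exact hpos x hx

end Quadratic

section FeasibleDirections

variable {ι : Type*} [Finite ι]

theorem exists_pos_add_smul_nonneg {v y : ι → ℝ} (hv : 0 ≤ v) (hy : ∀ i, v i = 0 → 0 ≤ y i) :
    ∃ t : ℝ, 0 < t ∧ 0 ≤ v + t • y := by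
  have h : ∀ᶠ t : ℝ in nhdsWithin 0 (Set.Ioi 0), ∀ i, 0 ≤ v i + t * y i := by
    rw [Filter.eventually_all]
    intro i
    rcases (hv i).eq_or_lt with hi | hi
    · filter_upwards [self_mem_nhdsWithin] with t ht
      exact add_nonneg (hv i) (mul_nonneg (le_of_lt ht) (hy i hi.symm))
    · have hcont : Continuous fun t : ℝ => v i + t * y i := by fun_prop
      have hpos : ∀ᶠ t : ℝ in nhds 0, 0 < v i + t * y i :=
        hcont.continuousAt.eventually_const_lt (by simpa using hi)
      exact (hpos.filter_mono nhdsWithin_le_nhds).mono fun t ht => ht.le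
  obtain ⟨t, hnonneg, ht⟩ := (h.and self_mem_nhdsWithin).exists
  exact ⟨t, ht, fun i => by simpa using hnonneg i⟩

theorem exists_add_smul_boundary {v y : ι → ℝ} (hv : 0 ≤ v) (hy : ∃ i, y i < 0) :
    ∃ t : ℝ, 0 ≤ t ∧ 0 ≤ v + t • y ∧ ∃ i, y i < 0 ∧ v i + t * y i = 0 := by
  obtain ⟨i, (hi : y i < 0), hmin⟩ := Set.exists_min_image {i | y i < 0} (fun i => v i / -y i)
    (Set.toFinite _) hy
  have ht : 0 ≤ v i / -y i := div_nonneg (hv i) (neg_nonneg.2 hi.le)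
  refine ⟨v i / -y i, ht, fun k => ?_, i, hi, ?_⟩
  · change 0 ≤ v k + v i / -y i * y k
    rcases lt_or_ge (y k) 0 with hk | hk
    · have := (le_div_iff₀ (neg_pos.2 hk)).1 (hmin k hk)
      linarith
    · exact add_nonneg (hv k) (mul_nonneg ht hk)
  · rw [div_neg, neg_mul, div_mul_cancel₀ _ hi.ne, add_neg_cancel]

end FeasibleDirections

/-! ### Copositive matrices and their zeros -/

section Copositive

variable {n : ℕ} {A : Matrix (Fin n) (Fin n) ℝ}

theorem IsZeroOf.dotProduct_mulVec_nonneg (hA : IsCopositive A) {v : Fin n → ℝ}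
    (hv : IsZeroOf A v) {y : Fin n → ℝ} (hy : 0 ≤ y) : 0 ≤ y ⬝ᵥ (A *ᵥ v) := by
  have h : 0 ≤ 2 * y ⬝ᵥ (A *ᵥ v) :=
    nonneg_of_forall_pos_add_mul_nonneg (b := y ⬝ᵥ (A *ᵥ y)) fun t ht => by
      have hpos := hA.2 (v + t • y) (add_nonneg hv.2.1 (smul_nonneg ht.le hy))
      rw [dotProduct_mulVec_add_smul hA.1, hv.2.2, zero_add] at hpos
      exact nonneg_of_mul_nonneg_right hpos ht
  linarith

theorem IsZeroOf.mulVec_nonneg (hA : IsCopositive A) {v : Fin n → ℝ} (hv : IsZeroOf A v) :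
    0 ≤ A *ᵥ v := fun k => by
  simpa using hv.dotProduct_mulVec_nonneg hA (y := Pi.single k 1) (Pi.single_nonneg.2 zero_le_one)

theorem IsZeroOf.mulVec_eq_zero (hA : IsCopositive A) {v : Fin n → ℝ} (hv : IsZeroOf A v)
    {k : Fin n} (hk : v k ≠ 0) : (A *ᵥ v) k = 0 :=
  apply_eq_zero_of_dotProduct_eq_zero hv.2.1 (hv.mulVec_nonneg hA) hv.2.2 hk

theorem IsZeroOf.dotProduct_mulVec_eq_zero (hA : IsCopositive A) {v : Fin n → ℝ}
    (hv : IsZeroOf A v) {y : Fin n → ℝ} (hy : ∀ i, v i = 0 → y i = 0 ∨ (A *ᵥ v) i = 0) :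
    y ⬝ᵥ (A *ᵥ v) = 0 := by
  refine Finset.sum_eq_zero fun i _ => ?_
  by_cases hi : v i = 0
  · rcases hy i hi with h | h <;> rw [h] <;> ring
  · rw [hv.mulVec_eq_zero hA hi, mul_zero]

theorem IsZeroOf.mulVec_eq_zero_of_support_subset (hA : IsCopositive A) {v w : Fin n → ℝ}
    (hv : IsZeroOf A v) (hw : IsZeroOf A w) (h : ∀ i, v i = 0 → w i = 0) {k : Fin n}
    (hk : v k ≠ 0) : (A *ᵥ w) k = 0 := by
  have hvw : v ⬝ᵥ (A *ᵥ w) = 0 := by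
    rw [dotProduct_mulVec_comm hA.1]
    exact hv.dotProduct_mulVec_eq_zero hA fun i hi => Or.inl (h i hi)
  exact apply_eq_zero_of_dotProduct_eq_zero hv.2.1 (hw.mulVec_nonneg hA) hvw hk

/-- Second-order condition at the zero `v` in a feasible direction `y` of vanishing slope. -/
theorem IsZeroOf.dotProduct_mulVec_self_nonneg (hA : IsCopositive A) {v : Fin n → ℝ}
    (hv : IsZeroOf A v) {y : Fin n → ℝ} (hy : ∀ i, v i = 0 → 0 ≤ y i)
    (hyv : y ⬝ᵥ (A *ᵥ v) = 0) : 0 ≤ y ⬝ᵥ (A *ᵥ y) := by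
  obtain ⟨t, ht, hvy⟩ := exists_pos_add_smul_nonneg hv.2.1 hy
  have h := hA.2 _ hvy
  rw [dotProduct_mulVec_add_smul hA.1, hv.2.2, hyv, mul_zero, zero_add, zero_add] at h
  exact nonneg_of_mul_nonneg_right (nonneg_of_mul_nonneg_right h ht) ht

theorem IsZeroOf.smul {v : Fin n → ℝ} (hv : IsZeroOf A v) {c : ℝ} (hc : 0 < c) :
    IsZeroOf A (c • v) :=
  ⟨smul_ne_zero hc.ne' hv.1, smul_nonneg hc.le hv.2.1, by
    rw [mulVec_smul, dotProduct_smul, smul_dotProduct, hv.2.2, smul_zero, smul_zero]⟩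

theorem IsZeroOf.of_add_left {X C : Matrix (Fin n) (Fin n) ℝ} (hX : IsCopositive X)
    (hC : IsCopositive C) {v : Fin n → ℝ} (hv : IsZeroOf (X + C) v) : IsZeroOf X v := by
  have h := hv.2.2
  rw [add_mulVec, dotProduct_add] at h
  exact ⟨hv.1, hv.2.1, by linarith [hX.2 v hv.2.1, hC.2 v hv.2.1]⟩

theorem isCopositive_of_posSemidef (hA : A.PosSemidef) : IsCopositive A :=
  ⟨isHermitian_iff_isSymm.1 hA.isHermitian,
    fun x _ => by simpa using hA.dotProduct_mulVec_nonneg x⟩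

theorem IsExceptional.exists_dotProduct_mulVec_neg (hA : IsExceptional A) :
    ∃ x, x ⬝ᵥ (A *ᵥ x) < 0 := by
  by_contra! h
  exact hA.2 ⟨A, 0, posSemidef_of_dotProduct_mulVec_nonneg hA.1.1 h, isSymm_zero, by simp, by simp⟩

theorem IsExceptional.ne_zero (hA : IsExceptional A) : A ≠ 0 := by
  obtain ⟨x, hx⟩ := hA.exists_dotProduct_mulVec_neg
  rintro rfl
  simp at hx

theorem IsCopositive.exists_dotProduct_mulVec_pos (hA : IsCopositive A) (h0 : A ≠ 0) :
    ∃ x, 0 ≤ x ∧ 0 < x ⬝ᵥ (A *ᵥ x) := by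
  by_contra! h
  have hzero (x : Fin n → ℝ) (hx : 0 ≤ x) : x ⬝ᵥ (A *ᵥ x) = 0 := (h x hx).antisymm (hA.2 x hx)
  have hsingle (k : Fin n) : (0 : Fin n → ℝ) ≤ Pi.single k 1 := Pi.single_nonneg.2 zero_le_one
  refine h0 (Matrix.ext fun i j => ?_)
  have hij := hzero _ (add_nonneg (hsingle i) (smul_nonneg (zero_le_one' ℝ) (hsingle j)))
  rw [dotProduct_mulVec_add_smul hA.1, hzero _ (hsingle i), hzero _ (hsingle j),
    dotProduct_mulVec_comm hA.1] at hij
  simpa using hij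

theorem IsCopositive.nonneg_of_smul (hA : IsCopositive A) (h0 : A ≠ 0) {c : ℝ}
    (hc : IsCopositive (c • A)) : 0 ≤ c := by
  obtain ⟨x, hx, hpos⟩ := hA.exists_dotProduct_mulVec_pos h0
  have h := hc.2 x hx
  rw [smul_mulVec, dotProduct_smul, smul_eq_mul] at h
  exact nonneg_of_mul_nonneg_left h hpos

theorem isExtremalCopositive_of_forall (hA : IsCopositive A) (h0 : A ≠ 0)
    (h : ∀ X C, IsCopositive X → IsCopositive C → A = X + C → ∃ d : ℝ, X = d • A) :
    IsExtremalCopositive A := by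
  refine ⟨hA, h0, fun X C hX hC hXC => ?_⟩
  obtain ⟨d, hXd⟩ := h X C hX hC hXC
  have hCd : C = (1 - d) • A := by rw [sub_smul, one_smul, ← hXd, hXC, add_sub_cancel_left]
  exact ⟨d, 1 - d, hA.nonneg_of_smul h0 (hXd ▸ hX), hA.nonneg_of_smul h0 (hCd ▸ hC), hXd, hCd⟩

theorem dotProduct_sub_smul_mulVec (A X : Matrix (Fin n) (Fin n) ℝ) (s : ℝ) (x : Fin n → ℝ) :
    x ⬝ᵥ ((A - s • X) *ᵥ x) = x ⬝ᵥ (A *ᵥ x) - s * x ⬝ᵥ (X *ᵥ x) := by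
  rw [sub_mulVec, smul_mulVec, dotProduct_sub, dotProduct_smul, smul_eq_mul]

theorem IsCopositive.exists_isGreatest_sub_smul (hA : IsCopositive A)
    {X : Matrix (Fin n) (Fin n) ℝ} (hX : IsCopositive X) (h0 : X ≠ 0) :
    ∃ t : ℝ, IsGreatest {s | IsCopositive (A - s • X)} t := by
  set S : Set ℝ := {s | IsCopositive (A - s • X)}
  have hbound {x : Fin n → ℝ} (hx : 0 ≤ x) (hXx : 0 < x ⬝ᵥ (X *ᵥ x)) :
      x ⬝ᵥ (A *ᵥ x) / x ⬝ᵥ (X *ᵥ x) ∈ upperBounds S := fun s hs => by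
    rw [le_div_iff₀ hXx, ← sub_nonneg, ← dotProduct_sub_smul_mulVec]
    exact hs.2 x hx
  have hne : S.Nonempty := ⟨0, by simpa [S] using hA⟩
  obtain ⟨x, hx, hXx⟩ := hX.exists_dotProduct_mulVec_pos h0
  refine ⟨sSup S, ⟨hA.1.sub (hX.1.smul _), fun y hy => ?_⟩,
    fun s hs => le_csSup ⟨_, hbound hx hXx⟩ hs⟩
  rw [dotProduct_sub_smul_mulVec]
  rcases (hX.2 y hy).eq_or_lt with hXy | hXy
  · rw [← hXy, mul_zero, sub_zero]
    exact hA.2 y hy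
  · rw [sub_nonneg, ← le_div_iff₀ hXy]
    exact csSup_le hne (hbound hy hXy)

end Copositive

/-! ### Arcs of cyclic indices -/

section Cyclic

variable {n : ℕ} [NeZero n]

theorem ofNat_add_period (t : ℕ) : Fin.ofNat n (t + n) = Fin.ofNat n t :=
  Fin.ext (Nat.add_mod_right t n)

theorem exists_eq_ofNat_add (k : Fin n) (t : ℕ) : ∃ i < n, k = Fin.ofNat n (t + i) := by
  have hn : 0 < n := NeZero.pos n
  refine ⟨(k + (n - t % n)) % n, Nat.mod_lt _ hn, Fin.ext ?_⟩
  have ht : t % n < n := Nat.mod_lt t hn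
  rw [Fin.val_ofNat, Nat.add_mod_mod, ← Nat.mod_add_mod,
    show t % n + (k + (n - t % n)) = k + n by omega, Nat.add_mod_right, Nat.mod_eq_of_lt k.2]

theorem ofNat_add_inj {t i j : ℕ} (hi : i < n) (hj : j < n) :
    Fin.ofNat n (t + i) = Fin.ofNat n (t + j) ↔ i = j :=
  ⟨fun h => (Nat.ModEq.add_left_cancel' t (congrArg Fin.val h)).eq_of_lt_of_lt hi hj,
    fun h => by rw [h]⟩

theorem sum_eq_sum_range_ofNat_add {M : Type*} [AddCommMonoid M] (f : Fin n → M) (t : ℕ) {m : ℕ}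
    (hm : m ≤ n) (hf : ∀ i, m ≤ i → i < n → f (Fin.ofNat n (t + i)) = 0) :
    ∑ k, f k = ∑ i ∈ Finset.range m, f (Fin.ofNat n (t + i)) := by
  symm
  refine Finset.sum_of_injOn (fun i => Fin.ofNat n (t + i)) (fun i hi j hj h => ?_) (by simp)
    (fun k _ hk => ?_) fun _ _ => rfl
  · rw [Finset.coe_range, Set.mem_Iio] at hi hj
    exact (ofNat_add_inj (hi.trans_le hm) (hj.trans_le hm)).1 h
  · obtain ⟨i, hi, rfl⟩ := exists_eq_ofNat_add k t
    exact hf i (not_lt.1 fun h => hk ⟨i, by simpa using h, rfl⟩) hi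

theorem arc_ofNat (t : ℕ) (i : Fin (n - 2)) : arc n (Fin.ofNat n t) i = Fin.ofNat n (t + i) :=
  Fin.ext (Nat.mod_add_mod t n i)

theorem arc_injective (j : Fin n) : Function.Injective (arc n j) := fun i i' h =>
  Fin.ext ((ofNat_add_inj (t := j) (by omega) (by omega)).1 h)

theorem ofNat_add_mem_arcSet {t i : ℕ} (hi : i < n) :
    Fin.ofNat n (t + i) ∈ arcSet n (Fin.ofNat n t) ↔ i < n - 2 := by
  constructor
  · rintro ⟨j, hj⟩
    rw [arc_ofNat, ofNat_add_inj (by omega) hi] at hj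
    omega
  · exact fun h => ⟨⟨i, h⟩, arc_ofNat t ⟨i, h⟩⟩

theorem self_mem_arcSet (hn : 3 ≤ n) (j : Fin n) : j ∈ arcSet n j := by
  simpa using (ofNat_add_mem_arcSet (t := j) (NeZero.pos n)).2 (by omega)

theorem notMem_arcSet_iff (hn : 2 ≤ n) (k : Fin n) (t : ℕ) :
    k ∉ arcSet n (Fin.ofNat n t) ↔
      k = Fin.ofNat n (t + (n - 2)) ∨ k = Fin.ofNat n (t + (n - 1)) := by
  obtain ⟨i, hi, rfl⟩ := exists_eq_ofNat_add k t
  rw [ofNat_add_mem_arcSet hi, ofNat_add_inj hi (by omega), ofNat_add_inj hi (by omega)]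
  omega

theorem support_subset_arcSet_iff (hn : 2 ≤ n) (v : Fin n → ℝ) (t : ℕ) :
    Function.support v ⊆ arcSet n (Fin.ofNat n t) ↔
      v (Fin.ofNat n (t + (n - 2))) = 0 ∧ v (Fin.ofNat n (t + (n - 1))) = 0 := by
  rw [Function.support_subset_iff']
  simp only [notMem_arcSet_iff hn]
  exact ⟨fun h => ⟨h _ (.inl rfl), h _ (.inr rfl)⟩, by rintro ⟨h, h'⟩ _ (rfl | rfl) <;> assumption⟩

theorem exists_mem_arcSet_mem_arcSet (hn : 5 ≤ n) (k l : Fin n) :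
    ∃ j, k ∈ arcSet n j ∧ l ∈ arcSet n j := by
  obtain ⟨i, hi, rfl⟩ := exists_eq_ofNat_add l k
  rcases lt_or_ge i (n - 2) with h | h
  · refine ⟨k, self_mem_arcSet (by omega) k, ?_⟩
    simpa using (ofNat_add_mem_arcSet (t := k) hi).2 h
  · refine ⟨Fin.ofNat n (k + i), ?_, self_mem_arcSet (by omega) _⟩
    have hk := (ofNat_add_mem_arcSet (n := n) (t := k + i) (i := n - i) (by omega)).2 (by omega)
    rwa [show (k : ℕ) + i + (n - i) = k + n by omega, ofNat_add_period,
      Fin.ofNat_val_eq_self] at hk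

theorem apply_ofNat_add_eq_zero {v : Fin n → ℝ} {t : ℕ}
    (hv : Function.support v ⊆ arcSet n (Fin.ofNat n t)) {i : ℕ} (hi : n - 2 ≤ i) (hi' : i < n) :
    v (Fin.ofNat n (t + i)) = 0 :=
  Function.notMem_support.1 fun h => hi.not_gt ((ofNat_add_mem_arcSet hi').1 (hv h))

theorem dotProduct_eq_sum_arc {v : Fin n → ℝ} {t : ℕ}
    (hv : Function.support v ⊆ arcSet n (Fin.ofNat n t)) (w : Fin n → ℝ) :
    v ⬝ᵥ w = ∑ i ∈ Finset.range (n - 2), v (Fin.ofNat n (t + i)) * w (Fin.ofNat n (t + i)) :=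
  sum_eq_sum_range_ofNat_add _ t (Nat.sub_le n 2) fun i hi hi' => by
    rw [apply_ofNat_add_eq_zero hv hi hi', zero_mul]

theorem mulVec_apply_eq_sum_arc (A : Matrix (Fin n) (Fin n) ℝ) {v : Fin n → ℝ} {t : ℕ}
    (hv : Function.support v ⊆ arcSet n (Fin.ofNat n t)) (k : Fin n) :
    (A *ᵥ v) k =
      ∑ i ∈ Finset.range (n - 2), v (Fin.ofNat n (t + i)) * A k (Fin.ofNat n (t + i)) := by
  rw [mulVec, dotProduct_comm, dotProduct_eq_sum_arc hv]

theorem arcSubmatrix_mulVec_comp (A : Matrix (Fin n) (Fin n) ℝ) {j : Fin n} {v : Fin n → ℝ}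
    (hv : Function.support v ⊆ arcSet n j) :
    arcSubmatrix A j *ᵥ (v ∘ arc n j) = (A *ᵥ v) ∘ arc n j := by
  ext i
  refine Fintype.sum_of_injective (arc n j) (arc_injective j) _ _ (fun k hk => ?_) fun _ => rfl
  rw [Function.notMem_support.1 fun h => hk (hv h), mul_zero]

end Cyclic

/-! ### The face `F_u` -/

section Face

variable {n : ℕ} [NeZero n] {u : Fin n → Fin n → ℝ} {A : Matrix (Fin n) (Fin n) ℝ}

theorem HasCirculantSupports.support_subset (hu : HasCirculantSupports u) (j : Fin n) :
    Function.support (u j) ⊆ arcSet n j :=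
  (hu j).2.le

theorem HasCirculantSupports.pos_iff (hu : HasCirculantSupports u) (j k : Fin n) :
    0 < u j k ↔ k ∈ arcSet n j := by
  rw [← (hu j).2, Function.mem_support]
  exact ((hu j).1 k).lt_iff_ne'

theorem HasCirculantSupports.eq_zero_iff (hu : HasCirculantSupports u) (j k : Fin n) :
    u j k = 0 ↔ k ∉ arcSet n j := by
  rw [← (hu j).2, Function.notMem_support]

theorem HasCirculantSupports.pos (hu : HasCirculantSupports u) (t : ℕ) {i : ℕ} (hi : i < n - 2) :
    0 < u (Fin.ofNat n t) (Fin.ofNat n (t + i)) :=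
  (hu.pos_iff _ _).2 ((ofNat_add_mem_arcSet (by omega)).2 hi)

theorem HasCirculantSupports.pos_self (hu : HasCirculantSupports u) (hn : 3 ≤ n) (j : Fin n) :
    0 < u j j :=
  (hu.pos_iff j j).2 (self_mem_arcSet hn j)

theorem HasCirculantSupports.eq_zero (hu : HasCirculantSupports u) (t : ℕ) {i : ℕ}
    (hi : n - 2 ≤ i) (hi' : i < n) : u (Fin.ofNat n t) (Fin.ofNat n (t + i)) = 0 := by
  rw [hu.eq_zero_iff, ofNat_add_mem_arcSet hi']
  exact hi.not_gt

theorem isZeroOf_of_mem_copositiveFace (hn : 3 ≤ n) (hu : HasCirculantSupports u)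
    (hA : A ∈ copositiveFace u) (j : Fin n) : IsZeroOf A (u j) :=
  ⟨fun h => (hu.pos_self hn j).ne' (congrFun h j), (hu j).1, hA.2 j⟩

theorem mem_matrixSpace_iff (hu : HasCirculantSupports u) :
    A ∈ matrixSpace u ↔ A.IsSymm ∧ ∀ j, ∀ k ∈ arcSet n j, (A *ᵥ u j) k = 0 := by
  refine and_congr_right fun _ => forall_congr' fun j => ?_
  rw [arcSubmatrix_mulVec_comp A (hu.support_subset j), arcSet, Set.forall_mem_range]
  exact funext_iff

theorem mem_matrixSpace_of_mem_copositiveFace (hn : 3 ≤ n) (hu : HasCirculantSupports u)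
    (hA : A ∈ copositiveFace u) : A ∈ matrixSpace u :=
  (mem_matrixSpace_iff hu).2 ⟨hA.1.1, fun j _ hk =>
    (isZeroOf_of_mem_copositiveFace hn hu hA j).mulVec_eq_zero hA.1 ((hu.pos_iff j _).2 hk).ne'⟩

/-- Any two indices lie in a common arc, so a nonnegative summand of `A` vanishes entrywise. -/
theorem posSemidef_of_mem_copositiveFace_of_not_isExceptional (hn : 5 ≤ n)
    (hu : HasCirculantSupports u) (hA : A ∈ copositiveFace u) (h : ¬ IsExceptional A) :
    A.PosSemidef := by
  rw [IsExceptional, not_and_not_right] at h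
  obtain ⟨P, N, hP, -, hN, rfl⟩ := h hA.1
  have hN0 : N = 0 := Matrix.ext fun k l => by
    obtain ⟨j, hk, hl⟩ := exists_mem_arcSet_mem_arcSet hn k l
    have hsum := hA.2 j
    rw [add_mulVec, dotProduct_add] at hsum
    have hPu := (isCopositive_of_posSemidef hP).2 _ (hu j).1
    have hNu : 0 ≤ u j ⬝ᵥ (N *ᵥ u j) := dotProduct_nonneg_of_nonneg (hu j).1
      fun i => dotProduct_nonneg_of_nonneg (hN i) (hu j).1
    exact apply_eq_zero_of_dotProduct_mulVec_eq_zero hN (hu j).1 (by linarith)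
      ((hu.pos_iff j k).2 hk).ne' ((hu.pos_iff j l).2 hl).ne'
  rwa [hN0, add_zero]

theorem mulVec_eq_zero_of_mem_copositiveFace_of_not_isExceptional (hn : 5 ≤ n)
    (hu : HasCirculantSupports u) (hA : A ∈ copositiveFace u) (h : ¬ IsExceptional A) (j : Fin n) :
    A *ᵥ u j = 0 :=
  ((posSemidef_of_mem_copositiveFace_of_not_isExceptional hn hu hA h).dotProduct_mulVec_zero_iff
    (u j)).1 (by simpa using hA.2 j)

/-- If `(A u^j)_k = 0` then `A` is nonnegative on the hyperplane `x_m = 0`, where `m` is the other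
index outside of `I_j`; as `u^m` is a zero off that hyperplane, `A` cannot be exceptional. -/
theorem IsExceptional.mulVec_pos (hn : 3 ≤ n) (hu : HasCirculantSupports u)
    (hA : A ∈ copositiveFace u) (hexc : IsExceptional A) {j k : Fin n} (hk : k ∉ arcSet n j) :
    0 < (A *ᵥ u j) k := by
  have hzero := isZeroOf_of_mem_copositiveFace hn hu hA
  refine ((hzero j).mulVec_nonneg hA.1 k).lt_of_ne' fun hAk => ?_
  obtain ⟨m, hm⟩ : ∃ m, ∀ i, u j i = 0 → i = k ∨ i = m := by
    obtain ⟨t, rfl⟩ : ∃ t : ℕ, j = Fin.ofNat n t := ⟨j, (Fin.ofNat_val_eq_self j).symm⟩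
    simp only [hu.eq_zero_iff, notMem_arcSet_iff (show 2 ≤ n by omega)] at hk ⊢
    rcases hk with rfl | rfl
    exacts [⟨_, fun _ => id⟩, ⟨_, fun _ => Or.symm⟩]
  have hpos (x : Fin n → ℝ) (hxm : x m = 0) (hxk : 0 ≤ x k) : 0 ≤ x ⬝ᵥ (A *ᵥ x) := by
    refine (hzero j).dotProduct_mulVec_self_nonneg hA.1 (fun i hi => ?_)
      ((hzero j).dotProduct_mulVec_eq_zero hA.1 fun i hi => ?_)
    · rcases hm i hi with rfl | rfl
      exacts [hxk, hxm.ge]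
    · rcases hm i hi with rfl | rfl
      exacts [Or.inr hAk, Or.inl hxm]
  refine hexc.2 (exists_posSemidef_add_nonneg hA.1.1 (hu m).1 (hA.2 m)
    ((hzero m).mulVec_nonneg hA.1) (hu.pos_self hn m).ne' fun x hx => ?_)
  rcases le_total 0 (x k) with hxk | hxk
  · exact hpos x hx hxk
  · simpa [mulVec_neg] using hpos (-x) (by simp [hx]) (by simpa using hxk)

end Face

/-! ### Evaluation functionals -/

section Functionals

variable {n : ℕ} [NeZero n] {u : Fin n → Fin n → ℝ}

theorem dualMap_monodromy_evalAt (u : Fin n → Fin n → ℝ) (t : ℕ) :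
    (monodromy u).dualMap (evalAt u t) = evalAt u (t + n) := rfl

theorem sum_smul_evalAt_eq_zero (u : Fin n → Fin n → ℝ) (t : ℕ) :
    ∑ i ∈ Finset.range (n - 2), u (Fin.ofNat n t) (Fin.ofNat n (t + i)) • evalAt u (t + i) = 0 := by
  ext x
  have h := x.2 t
  simp only [arc_ofNat] at h
  rw [Fin.sum_univ_eq_sum_range (fun i => u (Fin.ofNat n t) (Fin.ofNat n (t + i)) *
    (x : ℕ → ℝ) (t + i))] at h
  rw [LinearMap.sum_apply]
  exact h

theorem evalAt_mem_span_succ (hn : 3 ≤ n) (hu : HasCirculantSupports u) (t : ℕ) :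
    evalAt u t ∈ Submodule.span ℝ (Set.range fun i : Fin (n - 3) => evalAt u (t + 1 + i)) := by
  have h := sum_smul_evalAt_eq_zero u t
  rw [show n - 2 = n - 3 + 1 by omega, Finset.sum_range_succ', add_zero] at h
  rw [← Submodule.smul_mem_iff _ (hu.pos_self hn _).ne', eq_neg_of_add_eq_zero_right h]
  refine Submodule.neg_mem _ (Submodule.sum_mem _ fun i hi => Submodule.smul_mem _ _
    (Submodule.subset_span ⟨⟨i, Finset.mem_range.1 hi⟩, ?_⟩))
  simp only [add_assoc, add_comm 1]

theorem top_le_span_evalAt (hn : 5 ≤ n) (hu : HasCirculantSupports u) (t : ℕ) :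
    ⊤ ≤ Submodule.span ℝ (Set.range fun i : Fin (n - 3) => evalAt u (t + i)) := by
  induction t with
  | zero =>
    rw [← (evalBasis hn hu).span_eq]
    simp only [zero_add, ← evalBasis_apply hn hu]
    rfl
  | succ t ih =>
    refine ih.trans (Submodule.span_le.2 ?_)
    rintro _ ⟨⟨_ | i, hi⟩, rfl⟩
    · exact evalAt_mem_span_succ (by omega) hu t
    · exact Submodule.subset_span ⟨⟨i, by omega⟩, by simp only [add_assoc, add_comm 1]⟩

theorem finrank_dual_solutionSpace (hn : 5 ≤ n) (hu : HasCirculantSupports u) :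
    Module.finrank ℝ (Module.Dual ℝ (solutionSpace u)) = n - 3 := by
  rw [Module.finrank_eq_card_basis (evalBasis hn hu), Fintype.card_fin]

theorem finiteDimensional_dual_solutionSpace (hn : 5 ≤ n) (hu : HasCirculantSupports u) :
    FiniteDimensional ℝ (Module.Dual ℝ (solutionSpace u)) :=
  (evalBasis hn hu).finiteDimensional_of_finite

/-- The basis `e_t, …, e_{t + d - 1}` of the dual of the solution space, generalizing `evalBasis`
to an arbitrary starting time. -/
noncomputable def windowBasis (hn : 5 ≤ n) (hu : HasCirculantSupports u) (t : ℕ) :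
    Module.Basis (Fin (n - 3)) ℝ (Module.Dual ℝ (solutionSpace u)) :=
  basisOfTopLeSpanOfCardEqFinrank (fun i : Fin (n - 3) => evalAt u (t + i))
    (top_le_span_evalAt hn hu t) (by rw [finrank_dual_solutionSpace hn hu, Fintype.card_fin])

@[simp]
theorem windowBasis_apply (hn : 5 ≤ n) (hu : HasCirculantSupports u) (t : ℕ) (i : Fin (n - 3)) :
    windowBasis hn hu t i = evalAt u (t + i) := by
  simp [windowBasis]

/-- The linear map `x ↦ ∑ x_k e_k`, where `k` runs over the `n - 2` consecutive times starting at
`t`. It transports vectors supported on an arc to functionals on the solution space. -/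
noncomputable def arcSum (u : Fin n → Fin n → ℝ) (t : ℕ) :
    (Fin n → ℝ) →ₗ[ℝ] Module.Dual ℝ (solutionSpace u) :=
  ∑ i ∈ Finset.range (n - 2), (LinearMap.proj (Fin.ofNat n (t + i))).smulRight (evalAt u (t + i))

theorem arcSum_apply (u : Fin n → Fin n → ℝ) (t : ℕ) (x : Fin n → ℝ) :
    arcSum u t x = ∑ i ∈ Finset.range (n - 2), x (Fin.ofNat n (t + i)) • evalAt u (t + i) := by
  simp [arcSum, LinearMap.sum_apply]

theorem arcSum_self (u : Fin n → Fin n → ℝ) (t : ℕ) : arcSum u t (u (Fin.ofNat n t)) = 0 := by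
  rw [arcSum_apply, sum_smul_evalAt_eq_zero]

theorem arcSum_single (u : Fin n → Fin n → ℝ) (t : ℕ) {i : ℕ} (hi : i < n - 2) :
    arcSum u t (Pi.single (Fin.ofNat n (t + i)) 1) = evalAt u (t + i) := by
  rw [arcSum_apply, Finset.sum_eq_single_of_mem i (Finset.mem_range.2 hi) fun j hj hji => ?_,
    Pi.single_eq_same, one_smul]
  rw [Finset.mem_range] at hj
  rw [Pi.single_eq_of_ne (by rwa [Ne, ofNat_add_inj (by omega) (by omega)]), zero_smul]

theorem windowBasis_repr_arcSum (hn : 5 ≤ n) (hu : HasCirculantSupports u) (t : ℕ)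
    {x : Fin n → ℝ} (hx : x (Fin.ofNat n (t + (n - 3))) = 0) (i : Fin (n - 3)) :
    (windowBasis hn hu t).repr (arcSum u t x) i = x (Fin.ofNat n (t + i)) := by
  rw [arcSum_apply, show n - 2 = n - 3 + 1 by omega, Finset.sum_range_succ, hx, zero_smul,
    add_zero, ← Fin.sum_univ_eq_sum_range (fun i => x (Fin.ofNat n (t + i)) • evalAt u (t + i))]
  simp only [← windowBasis_apply hn hu]
  rw [Module.Basis.repr_sum_self]

theorem exists_arcSum_eq (hn : 5 ≤ n) (hu : HasCirculantSupports u) (t : ℕ)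
    (w : Module.Dual ℝ (solutionSpace u)) :
    ∃ x : Fin n → ℝ, (∀ i, n - 3 ≤ i → i < n → x (Fin.ofNat n (t + i)) = 0) ∧
      arcSum u t x = w := by
  refine ⟨∑ i : Fin (n - 3), (windowBasis hn hu t).repr w i • Pi.single (Fin.ofNat n (t + i)) 1,
    fun i hi hi' => ?_, ?_⟩
  · rw [Finset.sum_apply]
    refine Finset.sum_eq_zero fun j _ => ?_
    have hne : Fin.ofNat n (t + i) ≠ Fin.ofNat n (t + j) := by
      rw [Ne, ofNat_add_inj hi' (by omega)]
      omega
    rw [Pi.smul_apply, Pi.single_eq_of_ne hne, smul_zero]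
  · conv_rhs => rw [← (windowBasis hn hu t).sum_repr w]
    rw [map_sum]
    refine Finset.sum_congr rfl fun i _ => ?_
    rw [map_smul, arcSum_single u t (by omega), windowBasis_apply]

theorem exists_arcSum_eq_of_support (hn : 5 ≤ n) (hu : HasCirculantSupports u) (t : ℕ)
    (w : Module.Dual ℝ (solutionSpace u)) :
    ∃ x : Fin n → ℝ, Function.support x ⊆ arcSet n (Fin.ofNat n t) ∧ arcSum u t x = w := by
  obtain ⟨x, hx, hxw⟩ := exists_arcSum_eq hn hu t w
  exact ⟨x, (support_subset_arcSet_iff (by omega) x t).2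
    ⟨hx _ (by omega) (by omega), hx _ (by omega) (by omega)⟩, hxw⟩

theorem exists_smul_eq_of_arcSum_eq_zero (hn : 5 ≤ n) (hu : HasCirculantSupports u) {t : ℕ}
    {x : Fin n → ℝ} (hx : Function.support x ⊆ arcSet n (Fin.ofNat n t))
    (h : arcSum u t x = 0) : ∃ c : ℝ, c • u (Fin.ofNat n t) = x := by
  set last := Fin.ofNat n (t + (n - 3))
  set c := x last / u (Fin.ofNat n t) last
  refine ⟨c, (sub_eq_zero.1 (funext fun k => ?_)).symm⟩
  have hlast : (x - c • u (Fin.ofNat n t)) last = 0 := by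
    rw [Pi.sub_apply, Pi.smul_apply, smul_eq_mul, div_mul_cancel₀ _ (hu.pos t (by omega)).ne',
      sub_self]
  have hsum : arcSum u t (x - c • u (Fin.ofNat n t)) = 0 := by
    rw [map_sub, map_smul, h, arcSum_self, smul_zero, sub_zero]
  obtain ⟨i, hi, rfl⟩ := exists_eq_ofNat_add k t
  rcases lt_trichotomy i (n - 3) with h' | rfl | h'
  · rw [← windowBasis_repr_arcSum hn hu t hlast ⟨i, h'⟩, hsum, map_zero]
    rfl
  · exact hlast
  · rw [Pi.sub_apply, Pi.smul_apply, apply_ofNat_add_eq_zero hx (by omega) hi,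
      hu.eq_zero t (by omega) hi, smul_zero, sub_zero, Pi.zero_apply]

end Functionals

/-! ### The bilinear form of a matrix -/

section Form

variable {n : ℕ} [NeZero n] {u : Fin n → Fin n → ℝ} (hn : 5 ≤ n) (hu : HasCirculantSupports u)
  (A : matrixSpace u)

theorem formOfMatrix_comm (x y : Module.Dual ℝ (solutionSpace u)) :
    formOfMatrix hn hu A x y = formOfMatrix hn hu A y x := by
  have hflip : formOfMatrix hn hu A = (formOfMatrix hn hu A).flip := by
    refine LinearMap.BilinForm.ext_basis (evalBasis hn hu) fun i j => ?_
    rw [LinearMap.BilinForm.flip_apply, evalBasis_apply, evalBasis_apply, formOfMatrix_evalAt,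
      formOfMatrix_evalAt]
    exact (A.2.1.apply _ _).symm
  conv_lhs => rw [hflip]
  rfl

theorem sum_mul_matrixSpace_eq_zero {A : Matrix (Fin n) (Fin n) ℝ} (hu : HasCirculantSupports u)
    (hA : A ∈ matrixSpace u) (t : ℕ) {i : ℕ} (hi : i < n - 2) :
    ∑ j ∈ Finset.range (n - 2), u (Fin.ofNat n t) (Fin.ofNat n (t + j)) *
      A (Fin.ofNat n (t + i)) (Fin.ofNat n (t + j)) = 0 := by
  rw [← mulVec_apply_eq_sum_arc A (hu.support_subset _)]
  exact ((mem_matrixSpace_iff hu).1 hA).2 _ _ ((ofNat_add_mem_arcSet (by omega)).2 hi)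

theorem sum_mul_form_eq_zero (B : LinearMap.BilinForm ℝ (Module.Dual ℝ (solutionSpace u)))
    (w : Module.Dual ℝ (solutionSpace u)) (t : ℕ) :
    ∑ j ∈ Finset.range (n - 2), u (Fin.ofNat n t) (Fin.ofNat n (t + j)) *
      B w (evalAt u (t + j)) = 0 := by
  simpa using congrArg (B w) (sum_smul_evalAt_eq_zero u t)

/-- The recursion determines the last entry of a row, both of the matrix and of the form. -/
theorem formOfMatrix_evalAt_row {t i : ℕ} (hi : i < n - 2)
    (h : ∀ j < n - 3, formOfMatrix hn hu A (evalAt u (t + i)) (evalAt u (t + j)) =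
      A.1 (Fin.ofNat n (t + i)) (Fin.ofNat n (t + j))) {j : ℕ} (hj : j < n - 2) :
    formOfMatrix hn hu A (evalAt u (t + i)) (evalAt u (t + j)) =
      A.1 (Fin.ofNat n (t + i)) (Fin.ofNat n (t + j)) := by
  rcases lt_or_ge j (n - 3) with hj' | hj'
  · exact h j hj'
  obtain rfl : j = n - 3 := by omega
  have hmatrix := sum_mul_matrixSpace_eq_zero hu A.2 t hi
  have hform := sum_mul_form_eq_zero (formOfMatrix hn hu A) (evalAt u (t + i)) t
  rw [show n - 2 = n - 3 + 1 by omega, Finset.sum_range_succ] at hmatrix hform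
  rw [Finset.sum_congr rfl fun j hj => by rw [h j (Finset.mem_range.1 hj)], ← hmatrix] at hform
  exact mul_left_cancel₀ (hu.pos t (by omega)).ne' (add_left_cancel hform)

theorem formOfMatrix_evalAt_of_forall_lt {t : ℕ}
    (h : ∀ i < n - 3, ∀ j < n - 3, formOfMatrix hn hu A (evalAt u (t + i)) (evalAt u (t + j)) =
      A.1 (Fin.ofNat n (t + i)) (Fin.ofNat n (t + j))) {i j : ℕ} (hi : i < n - 2)
    (hj : j < n - 2) :
    formOfMatrix hn hu A (evalAt u (t + i)) (evalAt u (t + j)) =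
      A.1 (Fin.ofNat n (t + i)) (Fin.ofNat n (t + j)) := by
  refine formOfMatrix_evalAt_row hn hu A hi (fun j hj => ?_) hj
  rw [formOfMatrix_comm, ← A.2.1.apply]
  exact formOfMatrix_evalAt_row hn hu A (by omega) (h j hj) hi

theorem formOfMatrix_evalAt_add (t : ℕ) {i j : ℕ} (hi : i < n - 2) (hj : j < n - 2) :
    formOfMatrix hn hu A (evalAt u (t + i)) (evalAt u (t + j)) =
      A.1 (Fin.ofNat n (t + i)) (Fin.ofNat n (t + j)) := by
  induction t generalizing i j with
  | zero =>
    refine formOfMatrix_evalAt_of_forall_lt hn hu A (fun i hi j hj => ?_) hi hj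
    rw [zero_add, zero_add]
    exact formOfMatrix_evalAt hn hu A ⟨i, hi⟩ ⟨j, hj⟩
  | succ t ih =>
    refine formOfMatrix_evalAt_of_forall_lt hn hu A (fun i hi j hj => ?_) hi hj
    rw [show t + 1 + i = t + (i + 1) by omega, show t + 1 + j = t + (j + 1) by omega]
    exact ih (by omega) (by omega)

theorem formOfMatrix_dualMap_monodromy (x y : Module.Dual ℝ (solutionSpace u)) :
    formOfMatrix hn hu A ((monodromy u).dualMap x) ((monodromy u).dualMap y) =
      formOfMatrix hn hu A x y := by
  have hcomp : (formOfMatrix hn hu A).comp (monodromy u).dualMap (monodromy u).dualMap =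
      formOfMatrix hn hu A := by
    refine LinearMap.BilinForm.ext_basis (evalBasis hn hu) fun i j => ?_
    rw [LinearMap.BilinForm.comp_apply, evalBasis_apply, evalBasis_apply, formOfMatrix_evalAt,
      dualMap_monodromy_evalAt, dualMap_monodromy_evalAt, add_comm (i : ℕ), add_comm (j : ℕ),
      formOfMatrix_evalAt_add hn hu A n (by omega) (by omega), add_comm n, add_comm n,
      ofNat_add_period, ofNat_add_period]
  exact congrArg (fun B : LinearMap.BilinForm ℝ _ => B x y) hcomp

theorem formOfMatrix_evalAt_arcSum {t : ℕ} {x : Fin n → ℝ}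
    (hx : Function.support x ⊆ arcSet n (Fin.ofNat n t)) {i : ℕ} (hi : i < n - 2) :
    formOfMatrix hn hu A (evalAt u (t + i)) (arcSum u t x) = (A.1 *ᵥ x) (Fin.ofNat n (t + i)) := by
  rw [mulVec_apply_eq_sum_arc A.1 hx, arcSum_apply, map_sum]
  refine Finset.sum_congr rfl fun j hj => ?_
  rw [map_smul, formOfMatrix_evalAt_add hn hu A t hi (Finset.mem_range.1 hj), smul_eq_mul]

theorem formOfMatrix_arcSum_arcSum {t : ℕ} {x : Fin n → ℝ}
    (hx : Function.support x ⊆ arcSet n (Fin.ofNat n t)) :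
    formOfMatrix hn hu A (arcSum u t x) (arcSum u t x) = x ⬝ᵥ (A.1 *ᵥ x) := by
  conv_lhs =>
    enter [2]
    rw [arcSum_apply u t x]
  rw [dotProduct_eq_sum_arc hx, map_sum]
  refine Finset.sum_congr rfl fun j hj => ?_
  rw [map_smul, formOfMatrix_comm, formOfMatrix_evalAt_arcSum hn hu A hx (Finset.mem_range.1 hj),
    smul_eq_mul]

theorem formOfMatrix_self_nonneg (hA : A.1 ∈ copositiveFace u)
    (w : Module.Dual ℝ (solutionSpace u)) : 0 ≤ formOfMatrix hn hu A w w := by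
  obtain ⟨x, hx, rfl⟩ := exists_arcSum_eq_of_support hn hu 0 w
  rw [formOfMatrix_arcSum_arcSum hn hu A hx]
  have hzero := isZeroOf_of_mem_copositiveFace (by omega) hu hA (Fin.ofNat n 0)
  have hsupport (i : Fin n) (hi : u (Fin.ofNat n 0) i = 0) : x i = 0 :=
    Function.notMem_support.1 fun hxi => (hu.eq_zero_iff _ i).1 hi (hx hxi)
  exact hzero.dotProduct_mulVec_self_nonneg hA.1 (fun i hi => (hsupport i hi).ge)
    (hzero.dotProduct_mulVec_eq_zero hA.1 fun i hi => Or.inl (hsupport i hi))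

/-- The failure of the form to agree with the matrix at the pair `e_t, e_{t + n - 2}`, the first one
not contained in an arc; it governs copositivity. -/
noncomputable def formDefect (t : ℕ) : ℝ :=
  A.1 (Fin.ofNat n t) (Fin.ofNat n (t + (n - 2))) -
    formOfMatrix hn hu A (evalAt u t) (evalAt u (t + (n - 2)))

theorem mulVec_eq_mul_formDefect (t : ℕ) :
    (A.1 *ᵥ u (Fin.ofNat n t)) (Fin.ofNat n (t + (n - 2))) =
      u (Fin.ofNat n t) (Fin.ofNat n t) * formDefect hn hu A t := by
  have hform := sum_mul_form_eq_zero (formOfMatrix hn hu A) (evalAt u (t + (n - 2))) t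
  rw [mulVec_apply_eq_sum_arc A.1 (hu.support_subset _), ← sub_zero (Finset.sum _ _), ← hform,
    ← Finset.sum_sub_distrib, show n - 2 = n - 3 + 1 by omega, Finset.sum_range_succ',
    Finset.sum_eq_zero fun i hi => ?_, zero_add, add_zero, formDefect, mul_sub, A.2.1.apply,
    formOfMatrix_comm, show n - 3 + 1 = n - 2 by omega]
  rw [Finset.mem_range] at hi
  have hagree := formOfMatrix_evalAt_add hn hu A (t + 1) (i := n - 3) (j := i) (by omega) (by omega)
  rw [show t + 1 + (n - 3) = t + (n - 3 + 1) by omega, show t + 1 + i = t + (i + 1) by omega]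
    at hagree
  rw [hagree, sub_self]

theorem sum_range_corner {M : Type*} [AddCommMonoid M] {m : ℕ} (hm : m ≠ 0) {g : ℕ → ℕ → M}
    (hg : ∀ i ≤ m, ∀ j ≤ m, ¬ (i = 0 ∧ j = m) → ¬ (i = m ∧ j = 0) → g i j = 0) :
    ∑ i ∈ Finset.range (m + 1), ∑ j ∈ Finset.range (m + 1), g i j = g 0 m + g m 0 := by
  have hle {i : ℕ} (hi : i ∈ Finset.range (m + 1)) : i ≤ m := Finset.mem_range_succ_iff.1 hi
  have h0 : 0 ∈ Finset.range (m + 1) := Finset.mem_range.2 (by omega)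
  have hmm : m ∈ Finset.range (m + 1) := Finset.mem_range.2 (by omega)
  rw [Finset.sum_eq_add_of_mem 0 m h0 hmm hm.symm fun i hi hne => Finset.sum_eq_zero fun j hj =>
      hg i (hle hi) j (hle hj) (by tauto) (by tauto),
    Finset.sum_eq_single_of_mem m hmm fun j hj hjm =>
      hg 0 m.zero_le j (hle hj) (by tauto) (by omega),
    Finset.sum_eq_single_of_mem 0 h0 fun j hj hj0 => hg m le_rfl j (hle hj) (by omega) (by tauto)]

theorem formOfMatrix_evalAt_eq_of_ne_corner (t : ℕ) {i j : ℕ} (hi : i ≤ n - 2) (hj : j ≤ n - 2)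
    (hij : ¬ (i = 0 ∧ j = n - 2)) (hji : ¬ (i = n - 2 ∧ j = 0)) :
    formOfMatrix hn hu A (evalAt u (t + i)) (evalAt u (t + j)) =
      A.1 (Fin.ofNat n (t + i)) (Fin.ofNat n (t + j)) := by
  by_cases h0 : i = 0 ∨ j = 0
  · exact formOfMatrix_evalAt_add hn hu A t (by omega) (by omega)
  · have h := formOfMatrix_evalAt_add hn hu A (t + 1) (i := i - 1) (j := j - 1) (by omega)
      (by omega)
    rwa [show t + 1 + (i - 1) = t + i by omega, show t + 1 + (j - 1) = t + j by omega] at h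

theorem dotProduct_mulVec_eq_sum_sum (M : Matrix (Fin n) (Fin n) ℝ) {t m : ℕ} (hm : m ≤ n)
    {x : Fin n → ℝ} (hx : ∀ i, m ≤ i → i < n → x (Fin.ofNat n (t + i)) = 0) :
    x ⬝ᵥ (M *ᵥ x) = ∑ i ∈ Finset.range m, ∑ j ∈ Finset.range m, x (Fin.ofNat n (t + i)) *
      x (Fin.ofNat n (t + j)) * M (Fin.ofNat n (t + i)) (Fin.ofNat n (t + j)) := by
  rw [dotProduct, sum_eq_sum_range_ofNat_add _ t hm fun i hi hi' => by rw [hx i hi hi', zero_mul]]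
  refine Finset.sum_congr rfl fun i _ => ?_
  rw [mulVec, dotProduct,
    sum_eq_sum_range_ofNat_add _ t hm fun j hj hj' => by rw [hx j hj hj', mul_zero],
    Finset.mul_sum]
  exact Finset.sum_congr rfl fun j _ => by ring

theorem exists_dotProduct_mulVec_eq_formOfMatrix_add (t : ℕ) {x : Fin n → ℝ}
    (hx : x (Fin.ofNat n (t + (n - 1))) = 0) :
    ∃ w, x ⬝ᵥ (A.1 *ᵥ x) = formOfMatrix hn hu A w w +
      2 * (x (Fin.ofNat n t) * x (Fin.ofNat n (t + (n - 2))) * formDefect hn hu A t) := by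
  refine ⟨∑ i ∈ Finset.range (n - 1), x (Fin.ofNat n (t + i)) • evalAt u (t + i), ?_⟩
  have hform : formOfMatrix hn hu A
      (∑ i ∈ Finset.range (n - 1), x (Fin.ofNat n (t + i)) • evalAt u (t + i))
      (∑ i ∈ Finset.range (n - 1), x (Fin.ofNat n (t + i)) • evalAt u (t + i)) =
      ∑ i ∈ Finset.range (n - 1), ∑ j ∈ Finset.range (n - 1),
        x (Fin.ofNat n (t + i)) * x (Fin.ofNat n (t + j)) *
          formOfMatrix hn hu A (evalAt u (t + i)) (evalAt u (t + j)) := by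
    rw [LinearMap.map_sum₂]
    refine Finset.sum_congr rfl fun i _ => ?_
    rw [map_sum]
    refine Finset.sum_congr rfl fun j _ => ?_
    rw [map_smul, map_smul, LinearMap.smul_apply, smul_eq_mul, smul_eq_mul]
    ring
  have hvanish (i : ℕ) (hi : n - 1 ≤ i) (hi' : i < n) : x (Fin.ofNat n (t + i)) = 0 := by
    rwa [show i = n - 1 by omega]
  rw [← sub_eq_iff_eq_add', hform, dotProduct_mulVec_eq_sum_sum A.1 (Nat.sub_le n 1) hvanish,
    ← Finset.sum_sub_distrib]
  simp only [← Finset.sum_sub_distrib, ← mul_sub]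
  rw [show n - 1 = n - 2 + 1 by omega, sum_range_corner (by omega) fun i hi j hj hij hji => by
      rw [formOfMatrix_evalAt_eq_of_ne_corner hn hu A t hi hj hij hji, sub_self, mul_zero],
    add_zero, formOfMatrix_comm hn hu A (evalAt u (t + (n - 2))),
    A.2.1.apply (Fin.ofNat n t), formDefect]
  ring

theorem isCopositive_of_formOfMatrix_nonneg (hB : ∀ w, 0 ≤ formOfMatrix hn hu A w w)
    (hAu : ∀ j, 0 ≤ A.1 *ᵥ u j) : IsCopositive A.1 := by
  have hdefect (t : ℕ) : 0 ≤ formDefect hn hu A t := by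
    have h := hAu (Fin.ofNat n t) (Fin.ofNat n (t + (n - 2)))
    rw [mulVec_eq_mul_formDefect hn hu A] at h
    exact nonneg_of_mul_nonneg_right h (hu.pos_self (by omega) _)
  have hboundary (x : Fin n → ℝ) (hx : 0 ≤ x) (k : Fin n) (hk : x k = 0) :
      0 ≤ x ⬝ᵥ (A.1 *ᵥ x) := by
    obtain ⟨w, hw⟩ := exists_dotProduct_mulVec_eq_formOfMatrix_add hn hu A (k + 1) (x := x) (by
      rwa [show (k : ℕ) + 1 + (n - 1) = k + n by omega, ofNat_add_period, Fin.ofNat_val_eq_self])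
    rw [hw]
    exact add_nonneg (hB w) (mul_nonneg zero_le_two (mul_nonneg (mul_nonneg (hx _) (hx _))
      (hdefect _)))
  refine ⟨A.2.1, fun x hx => ?_⟩
  obtain ⟨s, hs, hz, i, -, hi⟩ := exists_add_smul_boundary (v := x) (y := -u 0) hx
    ⟨0, by simpa using hu.pos_self (by omega) 0⟩
  obtain ⟨z, rfl⟩ : ∃ z, x = z + s • u 0 := ⟨x - s • u 0, (sub_add_cancel _ _).symm⟩
  rw [smul_neg, add_neg_cancel_right] at hz
  have hzz : 0 ≤ z ⬝ᵥ (A.1 *ᵥ z) := hboundary z hz i (by simpa using hi)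
  have hzu : 0 ≤ u 0 ⬝ᵥ (A.1 *ᵥ z) := by
    rw [dotProduct_mulVec_comm A.2.1]
    exact dotProduct_nonneg_of_nonneg hz (hAu 0)
  have huu : 0 ≤ u 0 ⬝ᵥ (A.1 *ᵥ u 0) := dotProduct_nonneg_of_nonneg (hu 0).1 (hAu 0)
  rw [dotProduct_mulVec_add_smul A.2.1]
  positivity

end Form

/-! ### Zeros of exceptional matrices -/

section Zeros

variable {n : ℕ} [NeZero n] {u : Fin n → Fin n → ℝ} {A : Matrix (Fin n) (Fin n) ℝ}

/-- The kernel of the principal submatrix `A_{I_j}`, encoded as a space of vectors supported on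
`I_j`. -/
def arcKernel (A : Matrix (Fin n) (Fin n) ℝ) (j : Fin n) : Submodule ℝ (Fin n → ℝ) where
  carrier := {x | Function.support x ⊆ arcSet n j ∧ ∀ k ∈ arcSet n j, (A *ᵥ x) k = 0}
  add_mem' := by
    rintro x y ⟨hx, hAx⟩ ⟨hy, hAy⟩
    refine ⟨(Function.support_add x y).trans (Set.union_subset hx hy), fun k hk => ?_⟩
    rw [mulVec_add, Pi.add_apply, hAx k hk, hAy k hk, add_zero]
  zero_mem' := ⟨by simp, by simp⟩
  smul_mem' := by
    rintro c x ⟨hx, hAx⟩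
    refine ⟨(Function.support_const_smul_subset c x).trans hx, fun k hk => ?_⟩
    rw [mulVec_smul, Pi.smul_apply, hAx k hk, smul_zero]

theorem mem_arcKernel_iff {j : Fin n} {x : Fin n → ℝ} :
    x ∈ arcKernel A j ↔ Function.support x ⊆ arcSet n j ∧ ∀ k ∈ arcSet n j, (A *ᵥ x) k = 0 :=
  Iff.rfl

theorem IsZeroOf.mem_arcKernel (hn : 3 ≤ n) (hu : HasCirculantSupports u)
    (hA : A ∈ copositiveFace u) {v : Fin n → ℝ} (hv : IsZeroOf A v) {j : Fin n}
    (hvj : Function.support v ⊆ arcSet n j) : v ∈ arcKernel A j :=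
  ⟨hvj, fun k hk =>
    (isZeroOf_of_mem_copositiveFace hn hu hA j).mulVec_eq_zero_of_support_subset hA.1 hv
      (fun i hi => Function.notMem_support.1 fun h => (hu.eq_zero_iff j i).1 hi (hvj h))
      ((hu.pos_iff j k).2 hk).ne'⟩

theorem self_mem_arcKernel (hn : 3 ≤ n) (hu : HasCirculantSupports u)
    (hA : A ∈ copositiveFace u) (j : Fin n) : u j ∈ arcKernel A j :=
  (isZeroOf_of_mem_copositiveFace hn hu hA j).mem_arcKernel hn hu hA (hu.support_subset j)

theorem isZeroOf_of_mem_arcKernel {j : Fin n} {x : Fin n → ℝ} (hx : x ∈ arcKernel A j)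
    (h0 : x ≠ 0) (hpos : 0 ≤ x) : IsZeroOf A x := by
  refine ⟨h0, hpos, Finset.sum_eq_zero fun k _ => ?_⟩
  by_cases hk : k ∈ arcSet n j
  · rw [hx.2 k hk, mul_zero]
  · rw [Function.notMem_support.1 fun h => hk (hx.1 h), zero_mul]

theorem IsExceptional.formDefect_pos (hn : 5 ≤ n) (hu : HasCirculantSupports u)
    (hA : A ∈ copositiveFace u) (hexc : IsExceptional A) (t : ℕ) :
    0 < formDefect hn hu ⟨A, mem_matrixSpace_of_mem_copositiveFace (by omega) hu hA⟩ t := by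
  have h := hexc.mulVec_pos (by omega) hu hA (j := Fin.ofNat n t)
    (k := Fin.ofNat n (t + (n - 2))) (by rw [ofNat_add_mem_arcSet (by omega)]; omega)
  rw [mulVec_eq_mul_formDefect hn hu
    ⟨A, mem_matrixSpace_of_mem_copositiveFace (by omega) hu hA⟩] at h
  exact pos_of_mul_pos_right h (hu.pos_self (by omega) _).le

/-- On the hyperplane `v_{t - 1} = 0` the value `vᵀ A v` is at least `v_t v_{t - 2}` times a
positive constant. -/
theorem IsExceptional.apply_eq_zero_or_of_apply_eq_zero (hn : 5 ≤ n)
    (hu : HasCirculantSupports u) (hA : A ∈ copositiveFace u) (hexc : IsExceptional A)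
    {v : Fin n → ℝ} (hv : IsZeroOf A v) {t : ℕ} (h : v (Fin.ofNat n (t + (n - 1))) = 0) :
    v (Fin.ofNat n t) = 0 ∨ v (Fin.ofNat n (t + (n - 2))) = 0 := by
  set A' : matrixSpace u := ⟨A, mem_matrixSpace_of_mem_copositiveFace (by omega) hu hA⟩
  obtain ⟨w, hw⟩ := exists_dotProduct_mulVec_eq_formOfMatrix_add hn hu A' t h
  have hform := formOfMatrix_self_nonneg hn hu A' hA w
  have hdefect := hexc.formDefect_pos hn hu hA t
  have hprod := mul_nonneg (mul_nonneg (hv.2.1 (Fin.ofNat n t))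
    (hv.2.1 (Fin.ofNat n (t + (n - 2))))) hdefect.le
  rw [hv.2.2] at hw
  exact mul_eq_zero.1 ((mul_eq_zero.1 (by linarith)).resolve_right hdefect.ne')

theorem IsExceptional.exists_support_subset_arcSet (hn : 5 ≤ n) (hu : HasCirculantSupports u)
    (hA : A ∈ copositiveFace u) (hexc : IsExceptional A) {v : Fin n → ℝ} (hv : IsZeroOf A v) :
    ∃ j, Function.support v ⊆ arcSet n j := by
  obtain ⟨k, hk⟩ : ∃ k, v k = 0 := by
    by_contra! h
    obtain ⟨x, hx⟩ := hexc.exists_dotProduct_mulVec_neg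
    exact hx.not_ge (hv.dotProduct_mulVec_self_nonneg hA.1 (fun i hi => absurd hi (h i))
      (hv.dotProduct_mulVec_eq_zero hA.1 fun i hi => absurd hi (h i)))
  have hk' : v (Fin.ofNat n (k + 1 + (n - 1))) = 0 := by
    rwa [show (k : ℕ) + 1 + (n - 1) = k + n by omega, ofNat_add_period, Fin.ofNat_val_eq_self]
  rcases hexc.apply_eq_zero_or_of_apply_eq_zero hn hu hA hv hk' with h | h
  · refine ⟨Fin.ofNat n (k + 2), (support_subset_arcSet_iff (by omega) v _).2 ⟨?_, ?_⟩⟩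
    · rwa [show (k : ℕ) + 2 + (n - 2) = k + n by omega, ofNat_add_period, Fin.ofNat_val_eq_self]
    · rwa [show (k : ℕ) + 2 + (n - 1) = k + 1 + n by omega, ofNat_add_period]
  · exact ⟨Fin.ofNat n (k + 1), (support_subset_arcSet_iff (by omega) v _).2 ⟨h, hk'⟩⟩

theorem IsExceptional.mulVec_ne_zero (hn : 3 ≤ n) (hu : HasCirculantSupports u)
    (hA : A ∈ copositiveFace u) (hexc : IsExceptional A) {v : Fin n → ℝ} (hv : IsZeroOf A v) :
    A *ᵥ v ≠ 0 := by
  intro hAv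
  obtain ⟨k, hk⟩ : ∃ k, v k ≠ 0 := Function.ne_iff.1 hv.1
  have hk' : k ∉ arcSet n (Fin.ofNat n (k + 1)) := by
    rw [notMem_arcSet_iff (by omega), show (k : ℕ) + 1 + (n - 1) = k + n by omega,
      ofNat_add_period, Fin.ofNat_val_eq_self]
    exact Or.inr rfl
  have horth : v ⬝ᵥ (A *ᵥ u (Fin.ofNat n (k + 1))) = 0 := by
    rw [dotProduct_mulVec_comm hA.1.1, hAv, dotProduct_zero]
  exact (hexc.mulVec_pos hn hu hA hk').ne' (apply_eq_zero_of_dotProduct_eq_zero hv.2.1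
    ((isZeroOf_of_mem_copositiveFace hn hu hA _).mulVec_nonneg hA.1) horth hk)

/-- Two adjacent vanishing entries inside an arc put the support into a second arc; as the two
arcs cover all indices, the zero would be in the kernel of `A`. -/
theorem IsExceptional.apply_succ_ne_zero (hn : 3 ≤ n) (hu : HasCirculantSupports u)
    (hA : A ∈ copositiveFace u) (hexc : IsExceptional A) {v : Fin n → ℝ} (hv : IsZeroOf A v)
    {t : ℕ} (hvt : Function.support v ⊆ arcSet n (Fin.ofNat n t)) {i : ℕ} (hi : i + 1 < n - 2)
    (hvi : v (Fin.ofNat n (t + i)) = 0) : v (Fin.ofNat n (t + (i + 1))) ≠ 0 := by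
  intro hvi'
  have hvt' : Function.support v ⊆ arcSet n (Fin.ofNat n (t + i + 2)) := by
    refine (support_subset_arcSet_iff (by omega) v _).2 ⟨?_, ?_⟩
    · rwa [show t + i + 2 + (n - 2) = t + i + n by omega, ofNat_add_period]
    · rwa [show t + i + 2 + (n - 1) = t + (i + 1) + n by omega, ofNat_add_period]
  refine hexc.mulVec_ne_zero hn hu hA hv (funext fun k => ?_)
  obtain ⟨l, hl, rfl⟩ := exists_eq_ofNat_add k t
  rcases lt_or_ge l (n - 2) with hl' | hl'
  · exact (hv.mem_arcKernel hn hu hA hvt).2 _ ((ofNat_add_mem_arcSet hl).2 hl')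
  · refine (hv.mem_arcKernel hn hu hA hvt').2 _ ?_
    rw [show t + l = t + i + 2 + (l - (i + 2)) by omega]
    exact (ofNat_add_mem_arcSet (by omega)).2 (by omega)

theorem IsExceptional.apply_interior_ne_zero (hn : 5 ≤ n) (hu : HasCirculantSupports u)
    (hA : A ∈ copositiveFace u) (hexc : IsExceptional A) {v : Fin n → ℝ} (hv : IsZeroOf A v)
    {t : ℕ} (hvt : Function.support v ⊆ arcSet n (Fin.ofNat n t)) {i : ℕ} (hi0 : 0 < i)
    (hi : i < n - 3) : v (Fin.ofNat n (t + i)) ≠ 0 := by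
  intro h
  have h' : v (Fin.ofNat n (t + i + 1 + (n - 1))) = 0 := by
    rwa [show t + i + 1 + (n - 1) = t + i + n by omega, ofNat_add_period]
  rcases hexc.apply_eq_zero_or_of_apply_eq_zero hn hu hA hv h' with hnext | hprev
  · exact hexc.apply_succ_ne_zero (by omega) hu hA hv hvt (i := i) (by omega) h hnext
  · rw [show t + i + 1 + (n - 2) = t + (i - 1) + n by omega, ofNat_add_period] at hprev
    refine hexc.apply_succ_ne_zero (by omega) hu hA hv hvt (i := i - 1) (by omega) hprev ?_
    rwa [Nat.sub_add_cancel hi0]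

/-- Otherwise some `u^t + c x` with `c ≥ 0` would be a zero vanishing at an interior index. -/
theorem IsExceptional.nonneg_of_ends_nonneg (hn : 5 ≤ n) (hu : HasCirculantSupports u)
    (hA : A ∈ copositiveFace u) (hexc : IsExceptional A) {t : ℕ} {x : Fin n → ℝ}
    (hx : x ∈ arcKernel A (Fin.ofNat n t)) (hl : 0 ≤ x (Fin.ofNat n t))
    (hr : 0 ≤ x (Fin.ofNat n (t + (n - 3)))) : 0 ≤ x := by
  by_contra hneg
  obtain ⟨k, hk⟩ : ∃ k, x k < 0 := by simpa [Pi.le_def] using hneg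
  obtain ⟨c, hc, hc', k, hk, hk'⟩ := exists_add_smul_boundary (hu (Fin.ofNat n t)).1 ⟨k, hk⟩
  have hmem : u (Fin.ofNat n t) + c • x ∈ arcKernel A (Fin.ofNat n t) :=
    Submodule.add_mem _ (self_mem_arcKernel (by omega) hu hA _) (Submodule.smul_mem _ _ hx)
  have hend : 0 < (u (Fin.ofNat n t) + c • x) (Fin.ofNat n t) :=
    add_pos_of_pos_of_nonneg (hu.pos_self (by omega) _) (mul_nonneg hc hl)
  have hzero := isZeroOf_of_mem_arcKernel hmem (fun h => hend.ne' (congrFun h _)) hc'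
  obtain ⟨i, hi, rfl⟩ := exists_eq_ofNat_add k t
  have hi0 : i ≠ 0 := fun h => hk.not_ge (by simpa [h] using hl)
  have hi3 : i ≠ n - 3 := fun h => hk.not_ge (h ▸ hr)
  have hi2 : i < n - 2 := not_le.1 fun h => hk.ne (apply_ofNat_add_eq_zero hx.1 h hi)
  exact hexc.apply_interior_ne_zero hn hu hA hzero hmem.1 (by omega) (by omega) hk'

theorem IsExceptional.pos_of_ends_nonneg (hn : 5 ≤ n) (hu : HasCirculantSupports u)
    (hA : A ∈ copositiveFace u) (hexc : IsExceptional A) {t : ℕ} {x : Fin n → ℝ}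
    (hx : x ∈ arcKernel A (Fin.ofNat n t)) (h0 : x ≠ 0) (hl : 0 ≤ x (Fin.ofNat n t))
    (hr : 0 ≤ x (Fin.ofNat n (t + (n - 3)))) {i : ℕ} (hi0 : 0 < i) (hi : i < n - 3) :
    0 < x (Fin.ofNat n (t + i)) := by
  have hpos := hexc.nonneg_of_ends_nonneg hn hu hA hx hl hr
  exact (hpos _).lt_of_ne' (hexc.apply_interior_ne_zero hn hu hA
    (isZeroOf_of_mem_arcKernel hx h0 hpos) hx.1 hi0 hi)

theorem IsExceptional.eq_zero_of_ends_eq_zero (hn : 5 ≤ n) (hu : HasCirculantSupports u)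
    (hA : A ∈ copositiveFace u) (hexc : IsExceptional A) {t : ℕ} {x : Fin n → ℝ}
    (hx : x ∈ arcKernel A (Fin.ofNat n t)) (hl : x (Fin.ofNat n t) = 0)
    (hr : x (Fin.ofNat n (t + (n - 3))) = 0) : x = 0 :=
  le_antisymm
    (neg_nonneg.1 (hexc.nonneg_of_ends_nonneg hn hu hA (Submodule.neg_mem _ hx)
      (neg_nonneg.2 hl.le) (neg_nonneg.2 hr.le)))
    (hexc.nonneg_of_ends_nonneg hn hu hA hx hl.ge hr.ge)

/-- The entries of a vector at the two end indices of the arc starting at `t`. -/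
def arcEnds (n : ℕ) [NeZero n] (t : ℕ) : (Fin n → ℝ) →ₗ[ℝ] ℝ × ℝ :=
  (LinearMap.proj (Fin.ofNat n t)).prod (LinearMap.proj (Fin.ofNat n (t + (n - 3))))

theorem IsExceptional.arcEnds_domRestrict_injective (hn : 5 ≤ n) (hu : HasCirculantSupports u)
    (hA : A ∈ copositiveFace u) (hexc : IsExceptional A) (t : ℕ) :
    Function.Injective ((arcEnds n t).domRestrict (arcKernel A (Fin.ofNat n t))) := by
  rw [injective_iff_map_eq_zero]
  intro x hx
  obtain ⟨hl, hr⟩ := Prod.ext_iff.1 hx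
  exact Subtype.ext (hexc.eq_zero_of_ends_eq_zero hn hu hA x.2 hl hr)

theorem IsExceptional.finrank_arcKernel_le (hn : 5 ≤ n) (hu : HasCirculantSupports u)
    (hA : A ∈ copositiveFace u) (hexc : IsExceptional A) (t : ℕ) :
    Module.finrank ℝ (arcKernel A (Fin.ofNat n t)) ≤ 2 := by
  simpa using LinearMap.finrank_le_finrank_of_injective
    (hexc.arcEnds_domRestrict_injective hn hu hA t)

theorem map_extendByZero_ker_arcSubmatrix (A : Matrix (Fin n) (Fin n) ℝ) (j : Fin n) :
    (LinearMap.ker (arcSubmatrix A j).mulVecLin).map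
      (Function.ExtendByZero.linearMap ℝ (arc n j)) = arcKernel A j := by
  have hker {x : Fin n → ℝ} (hx : Function.support x ⊆ arcSet n j) :
      (∀ k ∈ arcSet n j, (A *ᵥ x) k = 0) ↔ arcSubmatrix A j *ᵥ (x ∘ arc n j) = 0 := by
    rw [arcSubmatrix_mulVec_comp A hx, arcSet, Set.forall_mem_range]
    exact funext_iff.symm
  ext x
  constructor
  · rintro ⟨v, hv, rfl⟩
    have hsupp : Function.support (Function.extend (arc n j) v 0) ⊆ arcSet n j :=
      Function.support_subset_iff'.2 fun k hk => Function.extend_apply' v _ k hk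
    refine ⟨hsupp, (hker hsupp).2 ?_⟩
    rw [Function.extend_comp (arc_injective j)]
    exact LinearMap.mem_ker.1 hv
  · intro hx
    refine ⟨x ∘ arc n j, LinearMap.mem_ker.2 ((hker hx.1).1 hx.2), funext fun k => ?_⟩
    by_cases hk : k ∈ arcSet n j
    · obtain ⟨i, rfl⟩ := hk
      exact (arc_injective j).extend_apply _ _ i
    · exact (Function.extend_apply' _ _ k hk).trans
        (Function.notMem_support.1 fun h => hk (hx.1 h)).symm

theorem matrixCorank_arcSubmatrix (A : Matrix (Fin n) (Fin n) ℝ) (j : Fin n) :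
    matrixCorank (arcSubmatrix A j) = Module.finrank ℝ (arcKernel A j) := by
  rw [← map_extendByZero_ker_arcSubmatrix]
  refine (Submodule.equivMapOfInjective _ (fun v w h => ?_) _).finrank_eq
  exact Function.extend_injective (arc_injective j) 0 h

theorem mem_arcKernel_iff_arcSum (hn : 5 ≤ n) (hu : HasCirculantSupports u) (A : matrixSpace u)
    {t : ℕ} {x : Fin n → ℝ} (hx : Function.support x ⊆ arcSet n (Fin.ofNat n t)) :
    x ∈ arcKernel A.1 (Fin.ofNat n t) ↔
      arcSum u t x ∈ LinearMap.ker (formOfMatrix hn hu A) := by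
  rw [LinearMap.mem_ker, mem_arcKernel_iff, and_iff_right hx, arcSet, Set.forall_mem_range]
  constructor
  · intro h
    refine (windowBasis hn hu t).ext fun i => ?_
    rw [formOfMatrix_comm, windowBasis_apply, formOfMatrix_evalAt_arcSum hn hu A hx (by omega),
      LinearMap.zero_apply, ← arc_ofNat t ⟨i, by omega⟩, h]
  · intro h i
    rw [arc_ofNat, ← formOfMatrix_evalAt_arcSum hn hu A hx i.2, formOfMatrix_comm, h,
      LinearMap.zero_apply]

theorem map_arcSum_arcKernel (hn : 5 ≤ n) (hu : HasCirculantSupports u) (A : matrixSpace u)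
    (t : ℕ) :
    (arcKernel A.1 (Fin.ofNat n t)).map (arcSum u t) = LinearMap.ker (formOfMatrix hn hu A) := by
  refine le_antisymm (Submodule.map_le_iff_le_comap.2 fun x hx =>
    (mem_arcKernel_iff_arcSum hn hu A hx.1).1 hx) fun w hw => ?_
  obtain ⟨x, hx, rfl⟩ := exists_arcSum_eq_of_support hn hu t w
  exact ⟨x, (mem_arcKernel_iff_arcSum hn hu A hx).2 hw, rfl⟩

theorem finrank_ker_arcSum_domRestrict (hn : 5 ≤ n) (hu : HasCirculantSupports u)
    (A : matrixSpace u) (t : ℕ) :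
    Module.finrank ℝ
      (LinearMap.ker ((arcSum u t).domRestrict (arcKernel A.1 (Fin.ofNat n t)))) = 1 := by
  have hu_mem : u (Fin.ofNat n t) ∈ arcKernel A.1 (Fin.ofNat n t) :=
    ⟨hu.support_subset _, ((mem_matrixSpace_iff hu).1 A.2).2 _⟩
  set f := (arcSum u t).domRestrict (arcKernel A.1 (Fin.ofNat n t))
  have hu_ker : ⟨u (Fin.ofNat n t), hu_mem⟩ ∈ LinearMap.ker f := arcSum_self u t
  refine finrank_eq_one (⟨_, hu_ker⟩ : LinearMap.ker f) (fun h => ?_) fun x => ?_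
  · have hval := congrArg (fun z => (z : arcKernel A.1 (Fin.ofNat n t)).1) (congrArg Subtype.val h)
    exact (hu.pos_self (by omega) _).ne' (congrFun hval (Fin.ofNat n t))
  · obtain ⟨c, hc⟩ := exists_smul_eq_of_arcSum_eq_zero hn hu x.1.2.1 x.2
    exact ⟨c, Subtype.ext (Subtype.ext hc)⟩

theorem finrank_arcKernel (hn : 5 ≤ n) (hu : HasCirculantSupports u) (A : matrixSpace u) (t : ℕ) :
    Module.finrank ℝ (arcKernel A.1 (Fin.ofNat n t)) = formCorank (formOfMatrix hn hu A) + 1 := by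
  rw [← LinearMap.finrank_range_add_finrank_ker
      ((arcSum u t).domRestrict (arcKernel A.1 (Fin.ofNat n t))),
    finrank_ker_arcSum_domRestrict hn hu, LinearMap.range_domRestrict,
    map_arcSum_arcKernel hn hu, formCorank]

end Zeros

/-! ### Matrices with two-dimensional kernels on the arcs -/

section Degenerate

variable {n : ℕ} [NeZero n] {u : Fin n → Fin n → ℝ} {A : Matrix (Fin n) (Fin n) ℝ} {t : ℕ}
  {v : Fin n → ℝ}

theorem mem_copositiveFace_of_add_left (hn : 3 ≤ n) (hu : HasCirculantSupports u)
    {X C : Matrix (Fin n) (Fin n) ℝ} (hX : IsCopositive X) (hC : IsCopositive C)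
    (hXC : X + C ∈ copositiveFace u) : X ∈ copositiveFace u :=
  ⟨hX, fun j => ((isZeroOf_of_mem_copositiveFace hn hu hXC j).of_add_left hX hC).2.2⟩

theorem ncard_arcSet (j : Fin n) : (arcSet n j).ncard = n - 2 := by
  rw [arcSet, Set.ncard_range_of_injective (arc_injective j), Nat.card_fin]

theorem left_mem_arcSet (hn : 3 ≤ n) (t : ℕ) : Fin.ofNat n t ∈ arcSet n (Fin.ofNat n t) :=
  self_mem_arcSet hn _

theorem right_mem_arcSet (hn : 3 ≤ n) (t : ℕ) :
    Fin.ofNat n (t + (n - 3)) ∈ arcSet n (Fin.ofNat n t) :=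
  (ofNat_add_mem_arcSet (by omega)).2 (by omega)

theorem left_ne_right (hn : 4 ≤ n) (t : ℕ) : Fin.ofNat n t ≠ Fin.ofNat n (t + (n - 3)) := by
  refine (ofNat_add_inj (t := t) (i := 0) (by omega) (by omega)).not.2 ?_
  omega

theorem IsExceptional.eq_left_or_eq_right_of_apply_eq_zero (hn : 5 ≤ n)
    (hu : HasCirculantSupports u) (hA : A ∈ copositiveFace u) (hexc : IsExceptional A)
    (hv : IsZeroOf A v) (hvt : Function.support v ⊆ arcSet n (Fin.ofNat n t)) {k : Fin n}
    (hk : k ∈ arcSet n (Fin.ofNat n t)) (hvk : v k = 0) :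
    k = Fin.ofNat n t ∨ k = Fin.ofNat n (t + (n - 3)) := by
  obtain ⟨i, hi, rfl⟩ := exists_eq_ofNat_add k t
  rw [ofNat_add_mem_arcSet hi] at hk
  by_contra! hne
  have hi0 : i ≠ 0 := by
    rintro rfl
    exact hne.1 rfl
  have hi3 : i ≠ n - 3 := by
    rintro rfl
    exact hne.2 rfl
  exact hexc.apply_interior_ne_zero hn hu hA hv hvt (by omega) (by omega) hvk

theorem IsExceptional.left_ne_zero_or_right_ne_zero (hn : 5 ≤ n) (hu : HasCirculantSupports u)
    (hA : A ∈ copositiveFace u) (hexc : IsExceptional A) (hv : IsZeroOf A v)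
    (hvt : Function.support v ⊆ arcSet n (Fin.ofNat n t)) :
    v (Fin.ofNat n t) ≠ 0 ∨ v (Fin.ofNat n (t + (n - 3))) ≠ 0 := by
  by_contra! hends
  exact hv.1 (hexc.eq_zero_of_ends_eq_zero hn hu hA (hv.mem_arcKernel (by omega) hu hA hvt)
    hends.1 hends.2)

theorem IsExceptional.support_eq_of_left_eq_zero (hn : 5 ≤ n) (hu : HasCirculantSupports u)
    (hA : A ∈ copositiveFace u) (hexc : IsExceptional A) (hv : IsZeroOf A v)
    (hvt : Function.support v ⊆ arcSet n (Fin.ofNat n t)) (hl : v (Fin.ofNat n t) = 0) :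
    Function.support v = arcSet n (Fin.ofNat n t) \ {Fin.ofNat n t} := by
  have hr := (hexc.left_ne_zero_or_right_ne_zero hn hu hA hv hvt).resolve_left (not_not.2 hl)
  refine (Set.subset_sdiff_singleton hvt (Function.notMem_support.2 hl)).antisymm
    fun k ⟨hk, hkl⟩ hvk => ?_
  rcases hexc.eq_left_or_eq_right_of_apply_eq_zero hn hu hA hv hvt hk hvk with rfl | rfl
  · exact hkl rfl
  · exact hr hvk

theorem IsExceptional.support_eq_of_right_eq_zero (hn : 5 ≤ n) (hu : HasCirculantSupports u)
    (hA : A ∈ copositiveFace u) (hexc : IsExceptional A) (hv : IsZeroOf A v)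
    (hvt : Function.support v ⊆ arcSet n (Fin.ofNat n t))
    (hr : v (Fin.ofNat n (t + (n - 3))) = 0) :
    Function.support v = arcSet n (Fin.ofNat n t) \ {Fin.ofNat n (t + (n - 3))} := by
  have hl := (hexc.left_ne_zero_or_right_ne_zero hn hu hA hv hvt).resolve_right (not_not.2 hr)
  refine (Set.subset_sdiff_singleton hvt (Function.notMem_support.2 hr)).antisymm
    fun k ⟨hk, hkr⟩ hvk => ?_
  rcases hexc.eq_left_or_eq_right_of_apply_eq_zero hn hu hA hv hvt hk hvk with rfl | rfl
  · exact hl hvk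
  · exact hkr rfl

theorem IsExceptional.eq_of_ends_eq (hn : 5 ≤ n) (hu : HasCirculantSupports u)
    (hA : A ∈ copositiveFace u) (hexc : IsExceptional A) {x y : Fin n → ℝ}
    (hx : x ∈ arcKernel A (Fin.ofNat n t)) (hy : y ∈ arcKernel A (Fin.ofNat n t))
    (hl : x (Fin.ofNat n t) = y (Fin.ofNat n t))
    (hr : x (Fin.ofNat n (t + (n - 3))) = y (Fin.ofNat n (t + (n - 3)))) : x = y :=
  sub_eq_zero.1 (hexc.eq_zero_of_ends_eq_zero hn hu hA (Submodule.sub_mem _ hx hy)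
    (sub_eq_zero.2 hl) (sub_eq_zero.2 hr))

theorem IsExceptional.exists_isZeroOf_of_ends (hn : 5 ≤ n) (hu : HasCirculantSupports u)
    (hA : A ∈ copositiveFace u) (hexc : IsExceptional A)
    (hrank : Module.finrank ℝ (arcKernel A (Fin.ofNat n t)) = 2) {a b : ℝ} (ha : 0 ≤ a)
    (hb : 0 ≤ b) (hab : a ≠ 0 ∨ b ≠ 0) :
    ∃ x, IsZeroOf A x ∧ Function.support x ⊆ arcSet n (Fin.ofNat n t) ∧
      x (Fin.ofNat n t) = a ∧ x (Fin.ofNat n (t + (n - 3))) = b := by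
  have hsurj : Function.Surjective ((arcEnds n t).domRestrict (arcKernel A (Fin.ofNat n t))) := by
    rw [← LinearMap.injective_iff_surjective_of_finrank_eq_finrank (by
      rw [hrank, Module.finrank_prod, Module.finrank_self])]
    exact hexc.arcEnds_domRestrict_injective hn hu hA t
  obtain ⟨⟨x, hx⟩, hxab⟩ := hsurj (a, b)
  obtain ⟨rfl, rfl⟩ : x (Fin.ofNat n t) = a ∧ x (Fin.ofNat n (t + (n - 3))) = b :=
    Prod.ext_iff.1 hxab
  have hx0 : x ≠ 0 := by
    rintro rfl
    simp at hab
  exact ⟨x, isZeroOf_of_mem_arcKernel hx hx0 (hexc.nonneg_of_ends_nonneg hn hu hA hx ha hb),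
    hx.1, rfl, rfl⟩

theorem IsExceptional.isMinimalZeroOf_of_ends (hn : 5 ≤ n) (hu : HasCirculantSupports u)
    (hA : A ∈ copositiveFace u) (hexc : IsExceptional A) (hv : IsZeroOf A v)
    (hvt : Function.support v ⊆ arcSet n (Fin.ofNat n t))
    (hends : v (Fin.ofNat n t) = 0 ∨ v (Fin.ofNat n (t + (n - 3))) = 0) :
    IsMinimalZeroOf A v := by
  refine ⟨hv, ?_⟩
  rintro ⟨w, hw, hsub, hne⟩
  obtain ⟨k, hvk, hwk⟩ := Set.not_subset.1 hne
  have hends_w := hexc.left_ne_zero_or_right_ne_zero hn hu hA hw (hsub.trans hvt)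
  have hvl : w (Fin.ofNat n t) ≠ 0 → v (Fin.ofNat n t) ≠ 0 := fun h => hsub h
  have hvr : w (Fin.ofNat n (t + (n - 3))) ≠ 0 → v (Fin.ofNat n (t + (n - 3))) ≠ 0 :=
    fun h => hsub h
  rw [Function.mem_support] at hvk
  rw [Function.notMem_support] at hwk
  rcases hexc.eq_left_or_eq_right_of_apply_eq_zero hn hu hA hw (hsub.trans hvt) (hvt hvk) hwk
    with rfl | rfl <;> tauto

theorem IsExceptional.ends_of_isMinimalZeroOf (hn : 5 ≤ n) (hu : HasCirculantSupports u)
    (hA : A ∈ copositiveFace u) (hexc : IsExceptional A)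
    (hrank : Module.finrank ℝ (arcKernel A (Fin.ofNat n t)) = 2) (hv : IsMinimalZeroOf A v)
    (hvt : Function.support v ⊆ arcSet n (Fin.ofNat n t)) :
    v (Fin.ofNat n t) = 0 ∨ v (Fin.ofNat n (t + (n - 3))) = 0 := by
  by_contra! hends
  obtain ⟨q, hq, hqt, -, hqr⟩ := hexc.exists_isZeroOf_of_ends hn hu hA hrank zero_le_one le_rfl
    (Or.inl one_ne_zero)
  refine hv.2 ⟨q, hq, fun k hk hvk => ?_, fun h => h hends.2 hqr⟩
  rcases hexc.eq_left_or_eq_right_of_apply_eq_zero hn hu hA hv.1 hvt (hqt hk) hvk with rfl | rfl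
  · exact hends.1 hvk
  · exact hends.2 hvk

theorem IsExceptional.hasNonMinimalCirculantZeroSupport (hn : 5 ≤ n)
    (hu : HasCirculantSupports u) (hA : A ∈ copositiveFace u) (hexc : IsExceptional A)
    (hrank : Module.finrank ℝ (arcKernel A (Fin.ofNat n t)) = 2) :
    HasNonMinimalCirculantZeroSupport A := by
  refine ⟨hexc, u, hu, isZeroOf_of_mem_copositiveFace (by omega) hu hA, fun hall => ?_⟩
  obtain ⟨q, hq, hqt, -, hqr⟩ := hexc.exists_isZeroOf_of_ends hn hu hA hrank zero_le_one le_rfl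
    (Or.inl one_ne_zero)
  obtain ⟨j, c, rfl⟩ := hall q hq
  have hc : c ≠ 0 := by
    rintro rfl
    exact hq.1 (zero_smul _ _)
  rw [Function.support_const_smul_of_ne_zero _ _ hc, (hu j).2] at hqt
  have harc : arcSet n j = arcSet n (Fin.ofNat n t) :=
    Set.eq_of_subset_of_ncard_le hqt (by rw [ncard_arcSet, ncard_arcSet])
  have hjr : Fin.ofNat n (t + (n - 3)) ∈ arcSet n j :=
    harc ▸ right_mem_arcSet (by omega) t
  exact mul_ne_zero hc ((hu.pos_iff j _).2 hjr).ne' hqr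

theorem IsExceptional.exists_support_ssubset_arcSet (hn : 5 ≤ n) (hu : HasCirculantSupports u)
    (hA : A ∈ copositiveFace u) (hexc : IsExceptional A)
    (hrank : ∀ j, Module.finrank ℝ (arcKernel A j) = 2)
    (hv : IsMinimalZeroOf A v) : ∃ j, Function.support v ⊂ arcSet n j := by
  obtain ⟨j, hvj⟩ := hexc.exists_support_subset_arcSet hn hu hA hv.1
  obtain ⟨t, rfl⟩ : ∃ t, j = Fin.ofNat n t := ⟨j, (Fin.ofNat_val_eq_self j).symm⟩
  refine ⟨_, hvj, fun h => ?_⟩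
  rcases hexc.ends_of_isMinimalZeroOf hn hu hA (hrank _) hv hvj with hl | hr
  · exact h (left_mem_arcSet (by omega) t) hl
  · exact h (right_mem_arcSet (by omega) t) hr

theorem IsExceptional.minimalZeroSupports_subset_arcSet (hn : 5 ≤ n)
    (hu : HasCirculantSupports u) (hA : A ∈ copositiveFace u) (hexc : IsExceptional A)
    (hrank : Module.finrank ℝ (arcKernel A (Fin.ofNat n t)) = 2) :
    {S ∈ minimalZeroSupports A | S ⊆ arcSet n (Fin.ofNat n t)} =
      {arcSet n (Fin.ofNat n t) \ {Fin.ofNat n t},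
        arcSet n (Fin.ofNat n t) \ {Fin.ofNat n (t + (n - 3))}} := by
  ext S
  constructor
  · rintro ⟨⟨v, hv, rfl⟩, hvt⟩
    exact (hexc.ends_of_isMinimalZeroOf hn hu hA hrank hv hvt).imp
      (hexc.support_eq_of_left_eq_zero hn hu hA hv.1 hvt)
      (hexc.support_eq_of_right_eq_zero hn hu hA hv.1 hvt)
  · rintro (rfl | rfl)
    · obtain ⟨p, hp, hpt, hpl, -⟩ := hexc.exists_isZeroOf_of_ends hn hu hA hrank le_rfl
        zero_le_one (Or.inr one_ne_zero)
      exact ⟨⟨p, hexc.isMinimalZeroOf_of_ends hn hu hA hp hpt (Or.inl hpl),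
        hexc.support_eq_of_left_eq_zero hn hu hA hp hpt hpl⟩, Set.sdiff_subset⟩
    · obtain ⟨q, hq, hqt, -, hqr⟩ := hexc.exists_isZeroOf_of_ends hn hu hA hrank zero_le_one
        le_rfl (Or.inl one_ne_zero)
      exact ⟨⟨q, hexc.isMinimalZeroOf_of_ends hn hu hA hq hqt (Or.inr hqr),
        hexc.support_eq_of_right_eq_zero hn hu hA hq hqt hqr⟩, Set.sdiff_subset⟩

theorem IsExceptional.ncard_minimalZeroSupports_subset_arcSet (hn : 5 ≤ n)
    (hu : HasCirculantSupports u) (hA : A ∈ copositiveFace u) (hexc : IsExceptional A)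
    (hrank : Module.finrank ℝ (arcKernel A (Fin.ofNat n t)) = 2) :
    {S ∈ minimalZeroSupports A | S ⊆ arcSet n (Fin.ofNat n t)}.ncard = 2 := by
  rw [hexc.minimalZeroSupports_subset_arcSet hn hu hA hrank, Set.ncard_pair]
  intro h
  have hr : Fin.ofNat n (t + (n - 3)) ∈ arcSet n (Fin.ofNat n t) \ {Fin.ofNat n t} :=
    ⟨right_mem_arcSet (by omega) t, (left_ne_right (by omega) t).symm⟩
  rw [h] at hr
  exact hr.2 rfl

theorem IsExceptional.support_eq_arcSet_and_exists_add (hn : 5 ≤ n)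
    (hu : HasCirculantSupports u) (hA : A ∈ copositiveFace u) (hexc : IsExceptional A)
    (hrank : ∀ j, Module.finrank ℝ (arcKernel A j) = 2)
    (hv : IsZeroOf A v) (hv' : ¬ IsMinimalZeroOf A v) :
    (∃ j, Function.support v = arcSet n j) ∧
      ∃ v₁ v₂, IsMinimalZeroOf A v₁ ∧ IsMinimalZeroOf A v₂ ∧ v = v₁ + v₂ := by
  obtain ⟨j, hvj⟩ := hexc.exists_support_subset_arcSet hn hu hA hv
  obtain ⟨t, rfl⟩ : ∃ t, j = Fin.ofNat n t := ⟨j, (Fin.ofNat_val_eq_self j).symm⟩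
  obtain ⟨hl, hr⟩ : v (Fin.ofNat n t) ≠ 0 ∧ v (Fin.ofNat n (t + (n - 3))) ≠ 0 :=
    not_or.1 fun hends => hv' (hexc.isMinimalZeroOf_of_ends hn hu hA hv hvj hends)
  obtain ⟨q, hq, hqt, hql, hqr⟩ := hexc.exists_isZeroOf_of_ends hn hu hA (hrank _)
    (hv.2.1 (Fin.ofNat n t)) le_rfl (Or.inl hl)
  obtain ⟨p, hp, hpt, hpl, hpr⟩ := hexc.exists_isZeroOf_of_ends hn hu hA (hrank _)
    le_rfl (hv.2.1 (Fin.ofNat n (t + (n - 3)))) (Or.inr hr)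
  refine ⟨⟨_, hvj.antisymm fun k hk hvk => ?_⟩, q, p,
    hexc.isMinimalZeroOf_of_ends hn hu hA hq hqt (Or.inr hqr),
    hexc.isMinimalZeroOf_of_ends hn hu hA hp hpt (Or.inl hpl), ?_⟩
  · rcases hexc.eq_left_or_eq_right_of_apply_eq_zero hn hu hA hv hvj hk hvk with rfl | rfl
    · exact hl hvk
    · exact hr hvk
  · refine hexc.eq_of_ends_eq hn hu hA (hv.mem_arcKernel (by omega) hu hA hvj)
      (Submodule.add_mem _ (hq.mem_arcKernel (by omega) hu hA hqt)
        (hp.mem_arcKernel (by omega) hu hA hpt)) ?_ ?_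
    · rw [Pi.add_apply, hql, hpl, add_zero]
    · rw [Pi.add_apply, hqr, hpr, zero_add]

/-- A zero of `A` supported on the arc starting at `t` without its last element. These zeros
probe single entries: `A *ᵥ q` vanishes except at the index following the arc. -/
structure IsLeftZeroOf (A : Matrix (Fin n) (Fin n) ℝ) (t : ℕ) (q : Fin n → ℝ) : Prop where
  isZeroOf : IsZeroOf A q
  support_subset : Function.support q ⊆ arcSet n (Fin.ofNat n t)
  right_eq_zero : q (Fin.ofNat n (t + (n - 3))) = 0

theorem IsLeftZeroOf.mulVec_apply_eq_zero (hn : 3 ≤ n) (hu : HasCirculantSupports u)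
    (hA : A ∈ copositiveFace u) {q : Fin n → ℝ} (hq : IsLeftZeroOf A t q) {k : Fin n}
    (hk : k ≠ Fin.ofNat n (t + (n - 2))) : (A *ᵥ q) k = 0 := by
  by_cases hkt : k ∈ arcSet n (Fin.ofNat n t)
  · exact (hq.isZeroOf.mem_arcKernel hn hu hA hq.support_subset).2 k hkt
  obtain rfl : k = Fin.ofNat n (t + (n - 1)) :=
    ((notMem_arcSet_iff (by omega) k t).1 hkt).resolve_left hk
  have hsupport : Function.support q ⊆ arcSet n (Fin.ofNat n (t + (n - 1))) := by
    refine (support_subset_arcSet_iff (by omega) q _).2 ⟨?_, ?_⟩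
    · rw [show t + (n - 1) + (n - 2) = t + (n - 3) + n by omega, ofNat_add_period]
      exact hq.right_eq_zero
    · rw [show t + (n - 1) + (n - 1) = t + (n - 2) + n by omega, ofNat_add_period]
      exact ((support_subset_arcSet_iff (by omega) q t).1 hq.support_subset).1
  exact (hq.isZeroOf.mem_arcKernel hn hu hA hsupport).2 _ (self_mem_arcSet hn _)

theorem IsLeftZeroOf.dotProduct_mulVec (hn : 3 ≤ n) (hu : HasCirculantSupports u)
    (hA : A ∈ copositiveFace u) {q : Fin n → ℝ} (hq : IsLeftZeroOf A t q) (z : Fin n → ℝ) :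
    z ⬝ᵥ (A *ᵥ q) = z (Fin.ofNat n (t + (n - 2))) * (A *ᵥ q) (Fin.ofNat n (t + (n - 2))) :=
  Finset.sum_eq_single _
    (fun k _ hk => by rw [hq.mulVec_apply_eq_zero hn hu hA hk, mul_zero]) (by simp)

theorem IsExceptional.mulVec_leftZero_ne_zero (hn : 3 ≤ n) (hu : HasCirculantSupports u)
    (hA : A ∈ copositiveFace u) (hexc : IsExceptional A) {q : Fin n → ℝ}
    (hq : IsLeftZeroOf A t q) : (A *ᵥ q) (Fin.ofNat n (t + (n - 2))) ≠ 0 := by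
  refine fun h => hexc.mulVec_ne_zero hn hu hA hq.isZeroOf (funext fun k => ?_)
  by_cases hk : k = Fin.ofNat n (t + (n - 2))
  · rw [hk, h, Pi.zero_apply]
  · exact hq.mulVec_apply_eq_zero hn hu hA hk

theorem IsExceptional.exists_mulVec_leftZero_eq_smul (hn : 3 ≤ n) (hu : HasCirculantSupports u)
    (hA : A ∈ copositiveFace u) (hexc : IsExceptional A) {X : Matrix (Fin n) (Fin n) ℝ}
    (hX : X ∈ copositiveFace u) {q : Fin n → ℝ} (hq : IsLeftZeroOf A t q)
    (hqX : IsZeroOf X q) : ∃ c : ℝ, X *ᵥ q = c • (A *ᵥ q) := by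
  have hqX' : IsLeftZeroOf X t q := ⟨hqX, hq.support_subset, hq.right_eq_zero⟩
  refine ⟨(X *ᵥ q) (Fin.ofNat n (t + (n - 2))) / (A *ᵥ q) (Fin.ofNat n (t + (n - 2))), ?_⟩
  ext k
  rw [Pi.smul_apply, smul_eq_mul]
  by_cases hk : k = Fin.ofNat n (t + (n - 2))
  · rw [hk, div_mul_cancel₀ _ (hexc.mulVec_leftZero_ne_zero hn hu hA hq)]
  · rw [hqX'.mulVec_apply_eq_zero hn hu hX hk, hq.mulVec_apply_eq_zero hn hu hA hk, mul_zero]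

theorem IsExceptional.eq_zero_of_forall_dotProduct_mulVec_leftZero (hn : 3 ≤ n)
    (hu : HasCirculantSupports u) (hA : A ∈ copositiveFace u) (hexc : IsExceptional A)
    {q : ℕ → Fin n → ℝ} (hq : ∀ t, IsLeftZeroOf A t (q t)) {z : Fin n → ℝ}
    (hz : ∀ t, z ⬝ᵥ (A *ᵥ q t) = 0) : z = 0 := by
  ext k
  have hzk := hz (k + 2)
  rw [(hq _).dotProduct_mulVec hn hu hA] at hzk
  have hindex : Fin.ofNat n ((k : ℕ) + 2 + (n - 2)) = k := by
    rw [show (k : ℕ) + 2 + (n - 2) = k + n by omega, ofNat_add_period, Fin.ofNat_val_eq_self]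
  exact hindex ▸ (mul_eq_zero.1 hzk).resolve_right (hexc.mulVec_leftZero_ne_zero hn hu hA (hq _))

theorem IsExceptional.mulVec_surjective_of_leftZeros (hn : 3 ≤ n) (hu : HasCirculantSupports u)
    (hA : A ∈ copositiveFace u) (hexc : IsExceptional A) {q : ℕ → Fin n → ℝ}
    (hq : ∀ t, IsLeftZeroOf A t (q t)) : Function.Surjective A.mulVec := by
  refine LinearMap.surjective_of_injective (f := A.mulVecLin) ?_
  rw [injective_iff_map_eq_zero]
  intro z hz
  refine hexc.eq_zero_of_forall_dotProduct_mulVec_leftZero hn hu hA hq fun t => ?_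
  rw [dotProduct_mulVec_comm hA.1.1, show A *ᵥ z = 0 from hz, dotProduct_zero]

theorem IsExceptional.eq_zero_of_forall_mulVec_leftZero (hn : 3 ≤ n)
    (hu : HasCirculantSupports u) (hA : A ∈ copositiveFace u) (hexc : IsExceptional A)
    {q : ℕ → Fin n → ℝ} (hq : ∀ t, IsLeftZeroOf A t (q t)) {Y : Matrix (Fin n) (Fin n) ℝ}
    (hY : ∀ t, Y *ᵥ q t = 0) : Y = 0 := by
  refine funext fun k => ?_
  obtain ⟨z, hz⟩ := hexc.mulVec_surjective_of_leftZeros hn hu hA hq (Y k)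
  have hz0 : z = 0 := by
    refine hexc.eq_zero_of_forall_dotProduct_mulVec_leftZero hn hu hA hq fun t => ?_
    rw [dotProduct_mulVec_comm hA.1.1, hz, dotProduct_comm]
    exact congrFun (hY t) k
  rw [← hz, hz0, mulVec_zero]
  rfl

theorem IsExceptional.leftZero_ratio_eq (hn : 3 ≤ n) (hu : HasCirculantSupports u)
    (hA : A ∈ copositiveFace u) (hexc : IsExceptional A) {X : Matrix (Fin n) (Fin n) ℝ}
    (hX : X.IsSymm) {p q : Fin n → ℝ} (hq : IsLeftZeroOf A t q)
    {c d : ℝ} (hXp : X *ᵥ p = c • (A *ᵥ p)) (hXq : X *ᵥ q = d • (A *ᵥ q))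
    (hp : p (Fin.ofNat n (t + (n - 2))) ≠ 0) : c = d := by
  have hcomm := dotProduct_mulVec_comm hX q p
  rw [hXp, hXq, dotProduct_smul, dotProduct_smul, dotProduct_mulVec_comm hA.1.1 q,
    hq.dotProduct_mulVec hn hu hA] at hcomm
  exact mul_right_cancel₀ (mul_ne_zero hp (hexc.mulVec_leftZero_ne_zero hn hu hA hq)) hcomm

theorem IsExceptional.leftZero_ratio_const (hn : 5 ≤ n) (hu : HasCirculantSupports u)
    (hA : A ∈ copositiveFace u) (hexc : IsExceptional A) {X : Matrix (Fin n) (Fin n) ℝ}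
    (hX : X.IsSymm) {q : ℕ → Fin n → ℝ} (hq : ∀ t, IsLeftZeroOf A t (q t))
    {c : ℕ → ℝ} (hc : ∀ t, X *ᵥ q t = c t • (A *ᵥ q t)) (s : ℕ) : c s = c 0 := by
  have ratio_two (s : ℕ) : c s = c (s + 2) := by
    refine hexc.leftZero_ratio_eq (by omega) hu hA hX (hq (s + 2)) (hc s) (hc _) ?_
    rw [show s + 2 + (n - 2) = s + n by omega, ofNat_add_period]
    exact (hexc.left_ne_zero_or_right_ne_zero hn hu hA (hq s).isZeroOf
      (hq s).support_subset).resolve_right (not_not.2 (hq s).right_eq_zero)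
  have ratio_three (s : ℕ) : c s = c (s + 3) := by
    refine hexc.leftZero_ratio_eq (by omega) hu hA hX (hq (s + 3)) (hc s) (hc _) ?_
    rw [show s + 3 + (n - 2) = s + 1 + n by omega, ofNat_add_period]
    exact hexc.apply_interior_ne_zero hn hu hA (hq s).isZeroOf (hq s).support_subset (by omega)
      (by omega)
  induction s with
  | zero => rfl
  | succ s ih => rw [← ih, ratio_two (s + 1), ratio_three s]

theorem IsExceptional.isExtremalCopositive_of_finrank_eq_two (hn : 5 ≤ n)
    (hu : HasCirculantSupports u) (hA : A ∈ copositiveFace u) (hexc : IsExceptional A)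
    (hrank : ∀ j, Module.finrank ℝ (arcKernel A j) = 2) :
    IsExtremalCopositive A := by
  refine isExtremalCopositive_of_forall hA.1 hexc.ne_zero fun X C hX hC hXC => ?_
  have hX_face : X ∈ copositiveFace u :=
    mem_copositiveFace_of_add_left (by omega) hu hX hC (hXC ▸ hA)
  have hleft (t : ℕ) : ∃ q, IsLeftZeroOf A t q := by
    obtain ⟨q, hq, hqt, -, hqr⟩ := hexc.exists_isZeroOf_of_ends hn hu hA (hrank _) zero_le_one
      le_rfl (Or.inl one_ne_zero)
    exact ⟨q, hq, hqt, hqr⟩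
  choose q hq using hleft
  choose c hc using fun t => hexc.exists_mulVec_leftZero_eq_smul (by omega) hu hA hX_face (hq t)
    ((hXC ▸ (hq t).isZeroOf : IsZeroOf (X + C) (q t)).of_add_left hX hC)
  refine ⟨c 0, sub_eq_zero.1 (hexc.eq_zero_of_forall_mulVec_leftZero (by omega) hu hA hq
    fun t => ?_)⟩
  rw [sub_mulVec, smul_mulVec, hc, hexc.leftZero_ratio_const hn hu hA hX.1 hq hc, sub_self]

theorem nonMinimalCase_of_formCorank_eq_one (hn : 5 ≤ n) (hu : HasCirculantSupports u)
    (hA : A ∈ copositiveFace u) (hexc : IsExceptional A) (hmem : A ∈ matrixSpace u)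
    (hB : formCorank (formOfMatrix hn hu ⟨A, hmem⟩) = 1) :
    NonMinimalCase u A (formOfMatrix hn hu ⟨A, hmem⟩) := by
  have hrank (j : Fin n) : Module.finrank ℝ (arcKernel A j) = 2 := by
    rw [← Fin.ofNat_val_eq_self j, finrank_arcKernel hn hu ⟨A, hmem⟩, hB]
  exact
    { nonminimal_support := hexc.hasNonMinimalCirculantZeroSupport hn hu hA (t := 0) (hrank _)
      corank_form := hB
      corank_submatrix := fun j => (matrixCorank_arcSubmatrix A j).trans (hrank j)
      minimal_zeros_strict := fun _ => hexc.exists_support_ssubset_arcSet hn hu hA hrank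
      two_minimal_supports := fun j => by
        rw [← Fin.ofNat_val_eq_self j]
        exact hexc.ncard_minimalZeroSupports_subset_arcSet hn hu hA (hrank _)
      nonminimal_zeros := fun _ => hexc.support_eq_arcSet_and_exists_add hn hu hA hrank
      extremal := hexc.isExtremalCopositive_of_finrank_eq_two hn hu hA hrank }

end Degenerate

/-! ### Subtracting a copositive matrix until the form degenerates -/

section Decrease

theorem exists_pos_mul_self_le_of_normedSpace {E : Type*} [NormedAddCommGroup E]
    [NormedSpace ℝ E] [FiniteDimensional ℝ E] {B D : LinearMap.BilinForm ℝ E}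
    (hB : ∀ w, w ≠ 0 → 0 < B w w) : ∃ ε : ℝ, 0 < ε ∧ ∀ w, ε * D w w ≤ B w w := by
  have hcont (F : LinearMap.BilinForm ℝ E) : Continuous fun w => F w w :=
    F.toContinuousBilinearMap.continuous.clm_apply continuous_id
  have hB_sphere (w : E) (hw : w ∈ Metric.sphere (0 : E) 1) : 0 < B w w :=
    hB w (ne_zero_of_mem_unit_sphere ⟨w, hw⟩)
  obtain ⟨K, hK⟩ := (isCompact_sphere (0 : E) 1).bddAbove_image
    ((hcont D).continuousOn.div (hcont B).continuousOn fun w hw => (hB_sphere w hw).ne')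
  have hK_pos : 0 < |K| + 1 := by positivity
  refine ⟨(|K| + 1)⁻¹, inv_pos.2 hK_pos, fun w => (inv_mul_le_iff₀ hK_pos).2 ?_⟩
  rcases eq_or_ne w 0 with rfl | hw
  · simp
  have hunit : ‖w‖⁻¹ • w ∈ Metric.sphere (0 : E) 1 := by
    rw [mem_sphere_zero_iff_norm, norm_smul, norm_inv, norm_norm,
      inv_mul_cancel₀ (norm_ne_zero_iff.2 hw)]
  have hratio := hK (Set.mem_image_of_mem _ hunit)
  simp only [Pi.div_apply, map_smul, LinearMap.smul_apply, smul_eq_mul] at hratio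
  rw [mul_div_mul_left _ _ (inv_ne_zero (norm_ne_zero_iff.2 hw)),
    mul_div_mul_left _ _ (inv_ne_zero (norm_ne_zero_iff.2 hw)), div_le_iff₀ (hB w hw)] at hratio
  exact hratio.trans (mul_le_mul_of_nonneg_right (by linarith [le_abs_self K]) (hB w hw).le)

theorem exists_pos_mul_self_le {V : Type*} [AddCommGroup V] [Module ℝ V] [FiniteDimensional ℝ V]
    {B D : LinearMap.BilinForm ℝ V} (hB : ∀ w, w ≠ 0 → 0 < B w w) :
    ∃ ε : ℝ, 0 < ε ∧ ∀ w, ε * D w w ≤ B w w := by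
  let e := (Module.finBasis ℝ V).equivFun.symm.toLinearMap
  obtain ⟨ε, hε, h⟩ := exists_pos_mul_self_le_of_normedSpace (B := B.comp e e) (D := D.comp e e)
    fun c hc => hB _ ((LinearEquiv.map_ne_zero_iff _).2 hc)
  refine ⟨ε, hε, fun w => ?_⟩
  simpa [e] using h ((Module.finBasis ℝ V).equivFun w)

theorem vecMulVec_self_mem_copositiveFace {n : ℕ} {u : Fin n → Fin n → ℝ} {y : Fin n → ℝ}
    (hyu : ∀ j, y ⬝ᵥ u j = 0) :
    vecMulVec y y ∈ copositiveFace u := by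
  refine ⟨isCopositive_of_posSemidef ?_, fun j => ?_⟩
  · simpa using posSemidef_vecMulVec_self_star y
  · rw [vecMulVec_mulVec, hyu, MulOpposite.op_zero, zero_smul, dotProduct_zero]

variable {n : ℕ} [NeZero n] {u : Fin n → Fin n → ℝ} {A : Matrix (Fin n) (Fin n) ℝ}

theorem mem_ker_formOfMatrix_iff (hn : 5 ≤ n) (hu : HasCirculantSupports u)
    (hA : A ∈ copositiveFace u) (hmem : A ∈ matrixSpace u) (w : Module.Dual ℝ (solutionSpace u)) :
    w ∈ LinearMap.ker (formOfMatrix hn hu ⟨A, hmem⟩) ↔ formOfMatrix hn hu ⟨A, hmem⟩ w w = 0 :=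
  (LinearMap.BilinForm.apply_apply_same_eq_zero_iff _ (formOfMatrix_self_nonneg hn hu _ hA)
    (LinearMap.BilinForm.isSymm_iff.1 ⟨formOfMatrix_comm hn hu _⟩)).symm

theorem isPosDefForm_of_formCorank_eq_zero (hn : 5 ≤ n) (hu : HasCirculantSupports u)
    (hA : A ∈ copositiveFace u) (hmem : A ∈ matrixSpace u)
    (hB : formCorank (formOfMatrix hn hu ⟨A, hmem⟩) = 0) :
    IsPosDefForm (formOfMatrix hn hu ⟨A, hmem⟩) := by
  have := finiteDimensional_dual_solutionSpace hn hu
  refine ⟨⟨formOfMatrix_comm hn hu _⟩, fun w hw => ?_⟩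
  refine (formOfMatrix_self_nonneg hn hu ⟨A, hmem⟩ hA w).lt_of_ne' fun h => hw ?_
  rwa [← mem_ker_formOfMatrix_iff hn hu hA hmem, Submodule.finrank_eq_zero.1 hB,
    Submodule.mem_bot] at h

theorem IsExceptional.formCorank_le_one (hn : 5 ≤ n) (hu : HasCirculantSupports u)
    (hA : A ∈ copositiveFace u) (hexc : IsExceptional A) (hmem : A ∈ matrixSpace u) :
    formCorank (formOfMatrix hn hu ⟨A, hmem⟩) ≤ 1 := by
  have h := hexc.finrank_arcKernel_le hn hu hA 0
  rw [finrank_arcKernel hn hu ⟨A, hmem⟩ 0] at h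
  omega

theorem IsExceptional.eventually_mulVec_sub_smul_nonneg (hn : 3 ≤ n)
    (hu : HasCirculantSupports u) (hA : A ∈ copositiveFace u) (hexc : IsExceptional A)
    {X : Matrix (Fin n) (Fin n) ℝ} (hX : X ∈ copositiveFace u) :
    ∀ᶠ δ : ℝ in nhds 0, ∀ j k, 0 ≤ ((A - δ • X) *ᵥ u j) k := by
  refine Filter.eventually_all.2 fun j => Filter.eventually_all.2 fun k => ?_
  simp only [sub_mulVec, smul_mulVec, Pi.sub_apply, Pi.smul_apply, smul_eq_mul]
  by_cases hk : k ∈ arcSet n j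
  · refine Filter.Eventually.of_forall fun δ => ?_
    rw [(self_mem_arcKernel hn hu hA j).2 k hk, (self_mem_arcKernel hn hu hX j).2 k hk, mul_zero,
      sub_zero]
  · have hcont : Continuous fun δ : ℝ => (A *ᵥ u j) k - δ * (X *ᵥ u j) k := by fun_prop
    have hpos : ∀ᶠ δ : ℝ in nhds 0, 0 < (A *ᵥ u j) k - δ * (X *ᵥ u j) k :=
      hcont.continuousAt.eventually_const_lt (by simpa using hexc.mulVec_pos hn hu hA hk)
    exact hpos.mono fun δ hδ => hδ.le

theorem IsExceptional.exists_sub_smul_isCopositive (hn : 5 ≤ n) (hu : HasCirculantSupports u)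
    (hA : A ∈ copositiveFace u) (hexc : IsExceptional A) (hmem : A ∈ matrixSpace u)
    (hB : IsPosDefForm (formOfMatrix hn hu ⟨A, hmem⟩)) {X : Matrix (Fin n) (Fin n) ℝ}
    (hX : X ∈ copositiveFace u) : ∃ ε : ℝ, 0 < ε ∧ IsCopositive (A - ε • X) := by
  have := finiteDimensional_dual_solutionSpace hn hu
  have hXmem := mem_matrixSpace_of_mem_copositiveFace (by omega) hu hX
  obtain ⟨ε, hε, hform⟩ :=
    exists_pos_mul_self_le (D := formOfMatrix hn hu ⟨X, hXmem⟩) hB.2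
  have hmulVec : ∀ᶠ δ : ℝ in nhdsWithin 0 (Set.Ioi 0), ∀ j k, 0 ≤ ((A - δ • X) *ᵥ u j) k :=
    (hexc.eventually_mulVec_sub_smul_nonneg (by omega) hu hA hX).filter_mono nhdsWithin_le_nhds
  obtain ⟨δ, hδu, hδ_pos, hδε⟩ := (hmulVec.and (Ioo_mem_nhdsGT hε)).exists
  refine ⟨δ, hδ_pos,
    isCopositive_of_formOfMatrix_nonneg hn hu (⟨A, hmem⟩ - δ • ⟨X, hXmem⟩) (fun w => ?_) hδu⟩
  rw [map_sub, map_smul, LinearMap.sub_apply, LinearMap.sub_apply, LinearMap.smul_apply,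
    LinearMap.smul_apply, smul_eq_mul, sub_nonneg]
  exact (mul_le_mul_of_nonneg_right hδε.le
    (formOfMatrix_self_nonneg hn hu ⟨X, hXmem⟩ hX w)).trans (hform w)

theorem exists_sub_smul_mem_copositiveFace_formCorank_eq_one (hn : 5 ≤ n)
    (hu : HasCirculantSupports u) (hA : A ∈ copositiveFace u) {X : Matrix (Fin n) (Fin n) ℝ}
    (hX : X ∈ copositiveFace u) (h0 : X ≠ 0) :
    ∃ t : ℝ, 0 ≤ t ∧ A - t • X ∈ copositiveFace u ∧
      (IsExceptional (A - t • X) → ∀ hmem,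
        formCorank (formOfMatrix hn hu ⟨A - t • X, hmem⟩) = 1) := by
  obtain ⟨t, ht, hmax⟩ := hA.1.exists_isGreatest_sub_smul hX.1 h0
  have hface : A - t • X ∈ copositiveFace u := by
    refine ⟨ht, fun j => ?_⟩
    rw [dotProduct_sub_smul_mulVec, hA.2, hX.2, mul_zero, sub_zero]
  refine ⟨t, hmax (by simpa using hA.1), hface, fun hexc hmem => ?_⟩
  have hle := hexc.formCorank_le_one hn hu hface hmem
  by_contra hne
  obtain ⟨ε, hε, hcop⟩ := hexc.exists_sub_smul_isCopositive hn hu hface hmem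
    (isPosDefForm_of_formCorank_eq_zero hn hu hface hmem (by omega)) hX
  have hle_t : t + ε ≤ t := hmax (by rwa [Set.mem_ofPred_eq, add_smul, ← sub_sub])
  linarith

theorem IsExceptional.exists_sub_smul_vecMulVec (hn : 5 ≤ n) (hu : HasCirculantSupports u)
    (hA : A ∈ copositiveFace u) (hexc : IsExceptional A) {y : Fin n → ℝ} (hy : y ≠ 0)
    (hyu : ∀ j, y ⬝ᵥ u j = 0) : ∃ t : ℝ, 0 ≤ t ∧ A - t • vecMulVec y y ∈ copositiveFace u ∧
      IsExceptional (A - t • vecMulVec y y) ∧ ∀ hmem,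
        formCorank (formOfMatrix hn hu ⟨A - t • vecMulVec y y, hmem⟩) = 1 := by
  obtain ⟨t, ht, hface, hcorank⟩ := exists_sub_smul_mem_copositiveFace_formCorank_eq_one hn hu hA
    (vecMulVec_self_mem_copositiveFace hyu) (by simpa using hy)
  have hexc' : IsExceptional (A - t • vecMulVec y y) := by
    by_contra hne
    have hker := mulVec_eq_zero_of_mem_copositiveFace_of_not_isExceptional (by omega) hu hface hne
      (Fin.ofNat n 0)
    rw [sub_mulVec, smul_mulVec, vecMulVec_mulVec, hyu, MulOpposite.op_zero, zero_smul, smul_zero,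
      sub_zero] at hker
    exact hexc.mulVec_ne_zero (by omega) hu hA
      (isZeroOf_of_mem_copositiveFace (by omega) hu hA _) hker
  exact ⟨t, ht, hface, hexc', hcorank hexc'⟩

end Decrease

/-! ### Odd periods -/

theorem hasEigenvalue_of_dualMap_apply_eq_smul {K V : Type*} [Field K] [AddCommGroup V]
    [Module K V] [FiniteDimensional K V] {f : Module.End K V} {μ : K} {w : Module.Dual K V}
    (hw : w ≠ 0) (h : f.dualMap w = μ • w) : f.HasEigenvalue μ := by
  have hmap : (f - algebraMap K (Module.End K V) μ).dualMap w = 0 := by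
    refine LinearMap.ext fun x => ?_
    have hx : w (f x) = μ * w x := congrArg (fun g : Module.Dual K V => g x) h
    simp [hx, Module.algebraMap_end_apply]
  rw [Module.End.hasEigenvalue_iff, Module.End.eigenspace_def]
  intro hbot
  refine hw (LinearMap.dualMap_injective_of_surjective ?_ (hmap.trans (map_zero _).symm))
  exact LinearMap.injective_iff_surjective.1 (LinearMap.ker_eq_bot.1 hbot)

theorem exists_forall_mem_ker_smul_eq_of_formCorank_eq_one {V : Type*} [AddCommGroup V]
    [Module ℝ V] {B : LinearMap.BilinForm ℝ V} (h : formCorank B = 1) :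
    ∃ w ∈ LinearMap.ker B, w ≠ 0 ∧ ∀ v ∈ LinearMap.ker B, ∃ c : ℝ, c • w = v := by
  obtain ⟨⟨w, hw⟩, hw0, hspan⟩ := finrank_eq_one_iff'.1 h
  refine ⟨w, hw, by rwa [Ne, Submodule.mk_eq_zero] at hw0, fun v hv => ?_⟩
  obtain ⟨c, hc⟩ := hspan ⟨v, hv⟩
  exact ⟨c, congrArg Subtype.val hc⟩

section OddPeriod

variable {n : ℕ} [NeZero n] {u : Fin n → Fin n → ℝ} {A : Matrix (Fin n) (Fin n) ℝ}

/-- The functional `w` has positive coordinates in the basis `e_t, …, e_{t + d - 1}`. -/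
def IsWindowPositive (hn : 5 ≤ n) (hu : HasCirculantSupports u) (t : ℕ)
    (w : Module.Dual ℝ (solutionSpace u)) : Prop :=
  ∀ i, 0 < (windowBasis hn hu t).repr w i

theorem IsWindowPositive.not_neg {hn : 5 ≤ n} {hu : HasCirculantSupports u} {t : ℕ}
    {w : Module.Dual ℝ (solutionSpace u)} (hw : IsWindowPositive hn hu t w) :
    ¬ IsWindowPositive hn hu t (-w) := fun hneg => by
  have hpos := hw ⟨0, by omega⟩
  have hpos' := hneg ⟨0, by omega⟩
  rw [map_neg, Finsupp.neg_apply] at hpos'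
  linarith

theorem isWindowPositive_dualMap_monodromy {hn : 5 ≤ n} {hu : HasCirculantSupports u} {t : ℕ}
    {w : Module.Dual ℝ (solutionSpace u)} (hw : IsWindowPositive hn hu t w) :
    IsWindowPositive hn hu (t + n) ((monodromy u).dualMap w) := by
  have hbasis (i : Fin (n - 3)) :
      windowBasis hn hu (t + n) i = (monodromy u).dualMap (windowBasis hn hu t i) := by
    rw [windowBasis_apply, windowBasis_apply, dualMap_monodromy_evalAt, add_right_comm]
  have hrepr : (monodromy u).dualMap w =
      ∑ i, (windowBasis hn hu t).repr w i • windowBasis hn hu (t + n) i := by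
    conv_lhs => rw [← (windowBasis hn hu t).sum_repr w]
    simp only [map_sum, map_smul, hbasis]
  intro i
  rw [hrepr, Module.Basis.repr_sum_self]
  exact hw i

theorem arcSum_succ (hn : 3 ≤ n) (u : Fin n → Fin n → ℝ) (t : ℕ) {x : Fin n → ℝ}
    (hfirst : x (Fin.ofNat n t) = 0) (hlast : x (Fin.ofNat n (t + (n - 2))) = 0) :
    arcSum u (t + 1) x = arcSum u t x := by
  rw [arcSum_apply, arcSum_apply, show n - 2 = n - 3 + 1 by omega, Finset.sum_range_succ,
    Finset.sum_range_succ', show t + 1 + (n - 3) = t + (n - 2) by omega, hlast, add_zero, hfirst,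
    zero_smul, zero_smul, add_zero, add_zero]
  refine Finset.sum_congr rfl fun i _ => ?_
  rw [add_right_comm, ← add_assoc]

theorem windowBasis_succ_repr_last (hn : 5 ≤ n) (hu : HasCirculantSupports u) (t : ℕ)
    (w : Module.Dual ℝ (solutionSpace u)) :
    (windowBasis hn hu (t + 1)).repr w ⟨n - 4, by omega⟩ =
      -((windowBasis hn hu t).repr w ⟨0, by omega⟩ / u (Fin.ofNat n t) (Fin.ofNat n t) *
        u (Fin.ofNat n t) (Fin.ofNat n (t + (n - 3)))) := by
  obtain ⟨x, hx, rfl⟩ := exists_arcSum_eq hn hu t w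
  set c := x (Fin.ofNat n t) / u (Fin.ofNat n t) (Fin.ofNat n t)
  have hfirst : (x - c • u (Fin.ofNat n t)) (Fin.ofNat n t) = 0 := by
    rw [Pi.sub_apply, Pi.smul_apply, smul_eq_mul,
      div_mul_cancel₀ _ (hu.pos_self (by omega) _).ne', sub_self]
  have hlast : (x - c • u (Fin.ofNat n t)) (Fin.ofNat n (t + (n - 2))) = 0 := by
    rw [Pi.sub_apply, Pi.smul_apply, hx _ (by omega) (by omega),
      hu.eq_zero t (by omega) (by omega), smul_zero, sub_zero]
  have hsum : arcSum u t x = arcSum u (t + 1) (x - c • u (Fin.ofNat n t)) := by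
    rw [arcSum_succ (by omega) u t hfirst hlast, map_sub, map_smul, arcSum_self, smul_zero,
      sub_zero]
  rw [windowBasis_repr_arcSum hn hu t (hx _ le_rfl (by omega)), hsum,
    windowBasis_repr_arcSum hn hu (t + 1) (by
      rwa [show t + 1 + (n - 3) = t + (n - 2) by omega])]
  dsimp only
  rw [show t + 1 + (n - 4) = t + (n - 3) by omega, Pi.sub_apply, Pi.smul_apply,
    hx _ le_rfl (by omega), zero_sub, smul_eq_mul, add_zero]

theorem IsExceptional.isWindowPositive_or_neg (hn : 5 ≤ n) (hu : HasCirculantSupports u)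
    (hA : A ∈ copositiveFace u) (hexc : IsExceptional A) (hmem : A ∈ matrixSpace u)
    {w : Module.Dual ℝ (solutionSpace u)}
    (hw : w ∈ LinearMap.ker (formOfMatrix hn hu ⟨A, hmem⟩)) (h0 : w ≠ 0) (t : ℕ) :
    IsWindowPositive hn hu t w ∨ IsWindowPositive hn hu t (-w) := by
  obtain ⟨x, hx, rfl⟩ := exists_arcSum_eq hn hu t w
  have hx_supp : Function.support x ⊆ arcSet n (Fin.ofNat n t) :=
    (support_subset_arcSet_iff (by omega) x t).2
      ⟨hx _ (by omega) (by omega), hx _ (by omega) (by omega)⟩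
  have hx_ker := (mem_arcKernel_iff_arcSum hn hu ⟨A, hmem⟩ hx_supp).2 hw
  have hlast := hx (n - 3) le_rfl (by omega)
  have hx_first : x (Fin.ofNat n t) ≠ 0 := fun hfirst => h0 (by
    rw [hexc.eq_zero_of_ends_eq_zero hn hu hA hx_ker hfirst hlast, map_zero])
  have hpos {y : Fin n → ℝ} (hy : y ∈ arcKernel A (Fin.ofNat n t))
      (hfirst : 0 < y (Fin.ofNat n t)) (hlast : y (Fin.ofNat n (t + (n - 3))) = 0) :
      IsWindowPositive hn hu t (arcSum u t y) := by
    intro i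
    rw [windowBasis_repr_arcSum hn hu t hlast]
    rcases Nat.eq_zero_or_pos i with hi | hi
    · rwa [hi, add_zero]
    · exact hexc.pos_of_ends_nonneg hn hu hA hy (fun h => hfirst.ne' (congrFun h _)) hfirst.le
        hlast.ge hi i.2
  rcases hx_first.lt_or_gt with hneg | hpos'
  · refine Or.inr ?_
    rw [← map_neg]
    exact hpos (Submodule.neg_mem _ hx_ker) (neg_pos.2 hneg) (neg_eq_zero.2 hlast)
  · exact Or.inl (hpos hx_ker hpos' hlast)

theorem IsExceptional.isWindowPositive_succ_neg (hn : 5 ≤ n) (hu : HasCirculantSupports u)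
    (hA : A ∈ copositiveFace u) (hexc : IsExceptional A) (hmem : A ∈ matrixSpace u)
    {w : Module.Dual ℝ (solutionSpace u)}
    (hw : w ∈ LinearMap.ker (formOfMatrix hn hu ⟨A, hmem⟩)) {t : ℕ}
    (hpos : IsWindowPositive hn hu t w) : IsWindowPositive hn hu (t + 1) (-w) := by
  have h0 : w ≠ 0 := by
    rintro rfl
    simpa using hpos ⟨0, by omega⟩
  refine (hexc.isWindowPositive_or_neg hn hu hA hmem hw h0 (t + 1)).resolve_left fun hsucc => ?_
  have hlast := hsucc ⟨n - 4, by omega⟩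
  rw [windowBasis_succ_repr_last] at hlast
  have := mul_pos (div_pos (hpos ⟨0, by omega⟩) (hu.pos_self (by omega) (Fin.ofNat n t)))
    (hu.pos t (i := n - 3) (by omega))
  linarith

theorem IsExceptional.isWindowPositive_neg_one_pow_smul (hn : 5 ≤ n)
    (hu : HasCirculantSupports u) (hA : A ∈ copositiveFace u) (hexc : IsExceptional A)
    (hmem : A ∈ matrixSpace u) {w : Module.Dual ℝ (solutionSpace u)}
    (hw : w ∈ LinearMap.ker (formOfMatrix hn hu ⟨A, hmem⟩))
    (hpos : IsWindowPositive hn hu 0 w) (t : ℕ) :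
    IsWindowPositive hn hu t ((-1 : ℝ) ^ t • w) := by
  induction t with
  | zero => simpa using hpos
  | succ t ih =>
    have hsucc := hexc.isWindowPositive_succ_neg hn hu hA hmem (Submodule.smul_mem _ _ hw) ih
    rwa [← neg_smul, ← mul_neg_one, ← pow_succ] at hsucc

/-- The sign of a functional in the kernel alternates from one window to the next, so after an odd
period it is reversed. -/
theorem IsExceptional.dualMap_monodromy_ne_self (hn : 5 ≤ n) (hodd : Odd n)
    (hu : HasCirculantSupports u) (hA : A ∈ copositiveFace u) (hexc : IsExceptional A)
    (hmem : A ∈ matrixSpace u) {w : Module.Dual ℝ (solutionSpace u)}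
    (hw : w ∈ LinearMap.ker (formOfMatrix hn hu ⟨A, hmem⟩)) (h0 : w ≠ 0) :
    (monodromy u).dualMap w ≠ w := by
  have hne {v : Module.Dual ℝ (solutionSpace u)}
      (hv : v ∈ LinearMap.ker (formOfMatrix hn hu ⟨A, hmem⟩))
      (hpos : IsWindowPositive hn hu 0 v) : (monodromy u).dualMap v ≠ v := by
    intro heq
    have hsame := isWindowPositive_dualMap_monodromy hpos
    have hopposite := hexc.isWindowPositive_neg_one_pow_smul hn hu hA hmem hv hpos n
    rw [zero_add, heq] at hsame
    rw [hodd.neg_one_pow, show (-1 : ℝ) • v = -v from neg_one_smul ℝ v] at hopposite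
    exact hsame.not_neg hopposite
  rcases hexc.isWindowPositive_or_neg hn hu hA hmem hw h0 0 with hpos | hpos
  · exact hne hw hpos
  · simpa using hne (Submodule.neg_mem _ hw) hpos

theorem dualMap_monodromy_mem_ker_formOfMatrix (hn : 5 ≤ n) (hu : HasCirculantSupports u)
    (hA : A ∈ copositiveFace u) (hmem : A ∈ matrixSpace u)
    {w : Module.Dual ℝ (solutionSpace u)}
    (hw : w ∈ LinearMap.ker (formOfMatrix hn hu ⟨A, hmem⟩)) :
    (monodromy u).dualMap w ∈ LinearMap.ker (formOfMatrix hn hu ⟨A, hmem⟩) := by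
  rwa [mem_ker_formOfMatrix_iff hn hu hA hmem, formOfMatrix_dualMap_monodromy,
    ← mem_ker_formOfMatrix_iff hn hu hA hmem]

theorem IsExceptional.hasEigenvalue_monodromy_neg_one (hn : 5 ≤ n) (hodd : Odd n)
    (hu : HasCirculantSupports u) (hA : A ∈ copositiveFace u) (hexc : IsExceptional A)
    (hmem : A ∈ matrixSpace u) (hcorank : formCorank (formOfMatrix hn hu ⟨A, hmem⟩) = 1)
    {D : matrixSpace u} (hD : IsPosDefForm (formOfMatrix hn hu D)) :
    (monodromy u).HasEigenvalue (-1) := by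
  obtain ⟨w, hw, hw0, hspan⟩ := exists_forall_mem_ker_smul_eq_of_formCorank_eq_one hcorank
  obtain ⟨c, hc⟩ := hspan _ (dualMap_monodromy_mem_ker_formOfMatrix hn hu hA hmem hw)
  have hc_sq : c * c = 1 := by
    have hinv := formOfMatrix_dualMap_monodromy hn hu D w w
    rw [← hc, map_smul, map_smul, LinearMap.smul_apply, smul_eq_mul, smul_eq_mul,
      ← mul_assoc] at hinv
    exact mul_right_cancel₀ (hD.2 w hw0).ne' (hinv.trans (one_mul _).symm)
  have hc_ne : c ≠ 1 := by
    rintro rfl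
    exact hexc.dualMap_monodromy_ne_self hn hodd hu hA hmem hw hw0 (hc.symm.trans (one_smul ℝ w))
  have := Module.Basis.finiteDimensional_of_finite (solutionBasis hn hu)
  obtain rfl := (mul_self_eq_one_iff.1 hc_sq).resolve_left hc_ne
  exact hasEigenvalue_of_dualMap_apply_eq_smul hw0 hc.symm

end OddPeriod

/-! ### Even periods -/

section Isometry

variable {K V : Type*} [Field K] [AddCommGroup V] [Module K V]

theorem det_toMatrix_comp {ι : Type*} [Fintype ι] [DecidableEq ι] (b : Module.Basis ι K V)
    (B : LinearMap.BilinForm K V) (f g : Module.End K V) :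
    (LinearMap.BilinForm.toMatrix b (B.comp f g)).det =
      LinearMap.det f * (LinearMap.BilinForm.toMatrix b B).det * LinearMap.det g := by
  rw [LinearMap.BilinForm.toMatrix_comp b b, det_mul, det_mul, det_transpose,
    LinearMap.det_toMatrix, LinearMap.det_toMatrix]

variable [FiniteDimensional K V] {B : LinearMap.BilinForm K V} {f : Module.End K V}

theorem det_mul_det_eq_one_of_comp_eq_self (hB : B.Nondegenerate) (hf : B.comp f f = B) :
    LinearMap.det f * LinearMap.det f = 1 := by
  let b := Module.finBasis K V
  have hdet := det_toMatrix_comp b B f f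
  rw [hf] at hdet
  refine mul_right_cancel₀ ((LinearMap.BilinForm.nondegenerate_iff_det_ne_zero b).1 hB) ?_
  linear_combination -hdet

/-- The relation `B (f x, (f - 1) y) = -B ((f - 1) x, y)` forces `det (f - 1) = -det (f - 1)`. -/
theorem hasEigenvalue_one_of_comp_eq_self [NeZero (2 : K)] (hodd : Odd (Module.finrank K V))
    (hB : B.Nondegenerate) (hf : B.comp f f = B) (hdet : LinearMap.det f = 1) :
    f.HasEigenvalue 1 := by
  let b := Module.finBasis K V
  have hB_det := (LinearMap.BilinForm.nondegenerate_iff_det_ne_zero b).1 hB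
  have hskew : B.comp f (f - 1) = B.comp (-(f - 1)) 1 := by
    ext x y
    have hxy : B (f x) (f y) = B x y := congrArg (fun C : LinearMap.BilinForm K V => C x y) hf
    simp [hxy]
  have hdet_skew := congrArg (fun C => (LinearMap.BilinForm.toMatrix b C).det) hskew
  rw [det_toMatrix_comp, det_toMatrix_comp, hdet, map_one, ← neg_one_smul K,
    LinearMap.det_smul, hodd.neg_one_pow] at hdet_skew
  have hdet_sub : LinearMap.det (f - 1) = 0 := by
    have h : 2 * (LinearMap.BilinForm.toMatrix b B).det * LinearMap.det (f - 1) = 0 := by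
      linear_combination hdet_skew
    exact (mul_eq_zero.1 h).resolve_left (mul_ne_zero two_ne_zero hB_det)
  rw [Module.End.hasEigenvalue_iff, Module.End.eigenspace_def, one_smul]
  exact (LinearMap.bot_lt_ker_of_det_eq_zero hdet_sub).ne'

end Isometry

theorem IsPosDefForm.nondegenerate {V : Type*} [AddCommGroup V] [Module ℝ V]
    {B : LinearMap.BilinForm ℝ V} (hB : IsPosDefForm B) : B.Nondegenerate := by
  refine ⟨fun x hx => ?_, fun x hx => ?_⟩ <;>
  · by_contra h0
    exact (hB.2 x h0).ne' (hx x)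

theorem det_eq_neg_one_pow_mul_repr_of_shift {R M : Type*} [CommRing R] [AddCommGroup M]
    [Module R M] {m : ℕ} (b : Module.Basis (Fin (m + 1)) R M) {v : Fin (m + 1) → M}
    (hv : ∀ i : Fin m, v i.castSucc = b i.succ) :
    b.det v = (-1) ^ m * b.repr (v (Fin.last m)) 0 := by
  have hrotate : v = Function.update b 0 (v (Fin.last m)) ∘ finRotate (m + 1) := by
    funext i
    refine Fin.lastCases ?_ (fun i => ?_) i
    · rw [Function.comp, finRotate_last, Function.update_self]
    · rw [Function.comp, hv, finRotate_apply, Fin.coeSucc_eq_succ,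
        Function.update_of_ne (Fin.succ_ne_zero i)]
  have hupdate : b.det (Function.update b 0 (v (Fin.last m))) = b.repr (v (Fin.last m)) 0 := by
    rw [Module.Basis.det_apply, Module.Basis.toMatrix_update, Module.Basis.toMatrix_self,
      ← cramer_apply, cramer_one, Module.End.one_apply]
  conv_lhs => rw [hrotate, AlternatingMap.map_perm, hupdate, sign_finRotate]
  simp [Units.smul_def]

section EvenPeriod

variable {n : ℕ} [NeZero n] {u : Fin n → Fin n → ℝ}

theorem windowBasis_repr_evalAt_add (hn : 5 ≤ n) (hu : HasCirculantSupports u) (t : ℕ)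
    (i : Fin (n - 3)) :
    (windowBasis hn hu t).repr (evalAt u (t + (n - 3))) i =
      -(u (Fin.ofNat n t) (Fin.ofNat n (t + i)) /
        u (Fin.ofNat n t) (Fin.ofNat n (t + (n - 3)))) := by
  set c := u (Fin.ofNat n t) (Fin.ofNat n (t + (n - 3)))
  have hc : c ≠ 0 := (hu.pos t (by omega)).ne'
  have heval : evalAt u (t + (n - 3)) =
      -c⁻¹ • arcSum u t (u (Fin.ofNat n t) - c • Pi.single (Fin.ofNat n (t + (n - 3))) 1) := by
    rw [map_sub, map_smul, arcSum_self, arcSum_single u t (by omega), zero_sub, smul_neg, neg_smul,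
      neg_neg, inv_smul_smul₀ hc]
  have hne : Fin.ofNat n (t + i) ≠ Fin.ofNat n (t + (n - 3)) := by
    rw [Ne, ofNat_add_inj (by omega) (by omega)]
    omega
  rw [heval, map_smul, Finsupp.smul_apply, windowBasis_repr_arcSum hn hu t (by simp [c]),
    Pi.sub_apply, Pi.smul_apply, Pi.single_eq_of_ne hne, smul_zero, sub_zero, smul_eq_mul]
  ring

theorem det_windowBasis_succ (hn : 5 ≤ n) (hu : HasCirculantSupports u) (t : ℕ) :
    (windowBasis hn hu t).det (windowBasis hn hu (t + 1)) =
      (-1) ^ (n - 3) * (u (Fin.ofNat n t) (Fin.ofNat n t) /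
        u (Fin.ofNat n t) (Fin.ofNat n (t + (n - 3)))) := by
  obtain ⟨m, rfl⟩ : ∃ m, n = m + 4 := ⟨n - 4, by omega⟩
  have hshift (i : Fin m) :
      windowBasis hn hu (t + 1) i.castSucc = windowBasis hn hu t i.succ := by
    rw [windowBasis_apply, windowBasis_apply, Fin.val_castSucc, Fin.val_succ, add_right_comm,
      ← add_assoc]
  have hlast : windowBasis hn hu (t + 1) (Fin.last m) = evalAt u (t + (m + 4 - 3)) := by
    rw [windowBasis_apply, Fin.val_last, add_assoc, add_comm 1]
    rfl
  rw [det_eq_neg_one_pow_mul_repr_of_shift (windowBasis hn hu t) hshift, hlast,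
    windowBasis_repr_evalAt_add, Fin.val_zero, add_zero, show m + 4 - 3 = m + 1 from rfl, pow_succ]
  ring

theorem det_dualMap_monodromy (hn : 5 ≤ n) (hu : HasCirculantSupports u) :
    LinearMap.det (monodromy u).dualMap =
      ∏ t ∈ Finset.range n, (-1) ^ (n - 3) * (u (Fin.ofNat n t) (Fin.ofNat n t) /
        u (Fin.ofNat n t) (Fin.ofNat n (t + (n - 3)))) := by
  have hdet (t : ℕ) : (windowBasis hn hu 0).det (windowBasis hn hu t) =
      ∏ s ∈ Finset.range t, (windowBasis hn hu s).det (windowBasis hn hu (s + 1)) := by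
    induction t with
    | zero => rw [Module.Basis.det_self, Finset.prod_range_zero]
    | succ t ih =>
      rw [Finset.prod_range_succ, ← ih, Module.Basis.det_apply, Module.Basis.det_apply,
        Module.Basis.det_apply, ← det_mul, Module.Basis.toMatrix_mul_toMatrix]
  have hperiod : windowBasis hn hu n = (monodromy u).dualMap ∘ windowBasis hn hu 0 := by
    funext i
    rw [Function.comp, windowBasis_apply, windowBasis_apply, dualMap_monodromy_evalAt, zero_add,
      add_comm]
  simp only [← det_windowBasis_succ hn hu, ← hdet, hperiod, Module.Basis.det_comp,
    Module.Basis.det_self, mul_one]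

theorem det_dualMap_monodromy_pos (hn : 5 ≤ n) (heven : Even n) (hu : HasCirculantSupports u) :
    0 < LinearMap.det (monodromy u).dualMap := by
  have hodd : Odd (n - 3) := Nat.Even.sub_odd (by omega) heven (by decide)
  simp only [det_dualMap_monodromy hn hu, hodd.neg_one_pow, neg_one_mul]
  rw [Finset.prod_neg, Finset.card_range, heven.neg_one_pow, one_mul]
  exact Finset.prod_pos fun t _ =>
    div_pos (hu.pos_self (by omega) _) (hu.pos t (by omega))

theorem hasEigenvalue_monodromy_one (hn : 5 ≤ n) (heven : Even n) (hu : HasCirculantSupports u)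
    {A : matrixSpace u} (hA : IsPosDefForm (formOfMatrix hn hu A)) :
    (monodromy u).HasEigenvalue 1 := by
  have := Module.Basis.finiteDimensional_of_finite (solutionBasis hn hu)
  have hinv : (formOfMatrix hn hu A).comp (monodromy u).dualMap (monodromy u).dualMap =
      formOfMatrix hn hu A :=
    LinearMap.ext₂ fun x y => formOfMatrix_dualMap_monodromy hn hu A x y
  have hodd : Odd (Module.finrank ℝ (Module.Dual ℝ (solutionSpace u))) := by
    rw [finrank_dual_solutionSpace hn hu]
    exact Nat.Even.sub_odd (by omega) heven (by decide)
  have hdet : LinearMap.det (monodromy u).dualMap = 1 :=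
    (mul_self_eq_one_iff.1 (det_mul_det_eq_one_of_comp_eq_self hA.nondegenerate hinv)).resolve_right
      fun h => by linarith [det_dualMap_monodromy_pos hn heven hu]
  obtain ⟨w, hw⟩ :=
    (hasEigenvalue_one_of_comp_eq_self hodd hA.nondegenerate hinv hdet).exists_hasEigenvector
  exact hasEigenvalue_of_dualMap_apply_eq_smul hw.2 hw.apply_eq_smul

theorem exists_dotProduct_eq_zero_of_hasEigenvalue_one (hu : HasCirculantSupports u)
    (h : (monodromy u).HasEigenvalue 1) : ∃ y : Fin n → ℝ, y ≠ 0 ∧ ∀ j, y ⬝ᵥ u j = 0 := by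
  obtain ⟨x, hx⟩ := h.exists_hasEigenvector
  have hperiodic : Function.Periodic (x : ℕ → ℝ) n := fun t => by
    have hmonodromy : monodromy u x = x := by rw [hx.apply_eq_smul, one_smul]
    exact congrFun (congrArg Subtype.val hmonodromy) t
  have hmod (t : ℕ) : (x : ℕ → ℝ) (Fin.ofNat n t : Fin n) = (x : ℕ → ℝ) t :=
    hperiodic.map_mod_nat t
  refine ⟨fun k => (x : ℕ → ℝ) k, fun h0 => hx.2 (Subtype.ext (funext fun t => ?_)), fun j => ?_⟩
  · rw [← hmod]
    exact congrFun h0 _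
  · have heq := x.2 j
    simp only [arc_ofNat] at heq
    rw [Fin.sum_univ_eq_sum_range fun i =>
      u (Fin.ofNat n j) (Fin.ofNat n (j + i)) * (x : ℕ → ℝ) (j + i)] at heq
    rw [dotProduct_comm, dotProduct_eq_sum_arc (t := j), ← heq]
    · simp only [Fin.ofNat_val_eq_self, hmod]
    · rw [Fin.ofNat_val_eq_self]
      exact hu.support_subset j

end EvenPeriod

/-! ### The two cases -/

theorem rank_vecMulVec_eq_one {K m n : Type*} [Field K] [Fintype n] {w : m → K} {v : n → K}
    (hw : w ≠ 0) (hv : v ≠ 0) : (vecMulVec w v).rank = 1 := by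
  classical
  refine le_antisymm (rank_vecMulVec_le w v) (Nat.one_le_iff_ne_zero.2 fun h => ?_)
  have hzero : toLin' (vecMulVec w v) = 0 :=
    LinearMap.range_eq_bot.1 (Submodule.finrank_eq_zero.1 h)
  obtain ⟨i, hi⟩ := Function.ne_iff.1 hw
  obtain ⟨j, hj⟩ := Function.ne_iff.1 hv
  exact mul_ne_zero hi hj (congrFun₂ (toLin'.map_eq_zero_iff.1 hzero) i j)

section Cases

variable {n : ℕ} [NeZero n] {u : Fin n → Fin n → ℝ} {A : Matrix (Fin n) (Fin n) ℝ}

theorem support_smul_eq_arcSet (hu : HasCirculantSupports u) (j : Fin n) {c : ℝ} (hc : c ≠ 0) :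
    Function.support (c • u j) = arcSet n j :=
  (Function.support_const_smul_of_ne_zero c (u j) hc).trans (hu j).2

theorem IsZeroOf.exists_eq_smul (hn : 3 ≤ n) (hu : HasCirculantSupports u)
    (hA : A ∈ copositiveFace u) {j : Fin n} (hrank : Module.finrank ℝ (arcKernel A j) = 1)
    {v : Fin n → ℝ} (hv : IsZeroOf A v) (hvj : Function.support v ⊆ arcSet n j) :
    ∃ c : ℝ, 0 < c ∧ v = c • u j := by
  have hne : (⟨u j, self_mem_arcKernel hn hu hA j⟩ : arcKernel A j) ≠ 0 := fun h =>
    (hu.pos_self hn j).ne' (congrFun (congrArg Subtype.val h) j)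
  obtain ⟨c, hc⟩ :=
    exists_smul_eq_of_finrank_eq_one hrank hne ⟨v, hv.mem_arcKernel hn hu hA hvj⟩
  obtain rfl : c • u j = v := congrArg Subtype.val hc
  have hc0 : c ≠ 0 := fun h => hv.1 (by rw [h, zero_smul])
  exact ⟨c, (nonneg_of_mul_nonneg_left (hv.2.1 j) (hu.pos_self hn j)).lt_of_ne' hc0, rfl⟩

theorem IsExceptional.isExtremalCopositive_of_odd (hn : 5 ≤ n) (hodd : Odd n)
    (hu : HasCirculantSupports u) (hA : A ∈ copositiveFace u) (hexc : IsExceptional A)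
    (hmem : A ∈ matrixSpace u) (hB : IsPosDefForm (formOfMatrix hn hu ⟨A, hmem⟩))
    (hM : ¬ (monodromy u).HasEigenvalue (-1)) : IsExtremalCopositive A := by
  refine isExtremalCopositive_of_forall hA.1 hexc.ne_zero fun X C hX hC hXC => ?_
  have hX_face := mem_copositiveFace_of_add_left (by omega) hu hX hC (hXC ▸ hA)
  by_cases hX0 : X = 0
  · exact ⟨0, by rw [hX0, zero_smul]⟩
  have not_isExceptional_of_corank {Y : Matrix (Fin n) (Fin n) ℝ} (hY : Y ∈ copositiveFace u)
      (hcorank : ∀ h, formCorank (formOfMatrix hn hu ⟨Y, h⟩) = 1) : ¬ IsExceptional Y :=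
    fun hY_exc => hM (hY_exc.hasEigenvalue_monodromy_neg_one hn hodd hu hY
      (mem_matrixSpace_of_mem_copositiveFace (by omega) hu hY) (hcorank _) hB)
  obtain ⟨t, -, hface, hcorank⟩ :=
    exists_sub_smul_mem_copositiveFace_formCorank_eq_one hn hu hA hX_face hX0
  have hmulVec := mulVec_eq_zero_of_mem_copositiveFace_of_not_isExceptional hn hu hface
    fun h => not_isExceptional_of_corank hface (hcorank h) h
  have hA_eq : A - t • X = 0 := by
    by_contra hne
    obtain ⟨k, hk⟩ : ∃ k, (A - t • X) k ≠ 0 := Function.ne_iff.1 hne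
    obtain ⟨s, -, hface', hexc', hcorank'⟩ :=
      hexc.exists_sub_smul_vecMulVec hn hu hA hk fun j => congrFun (hmulVec j) k
    exact not_isExceptional_of_corank hface' hcorank' hexc'
  rw [sub_eq_zero] at hA_eq
  have ht : t ≠ 0 := fun h => hexc.ne_zero (by rw [hA_eq, h, zero_smul])
  exact ⟨t⁻¹, by rw [hA_eq, inv_smul_smul₀ ht]⟩

theorem IsExceptional.exists_decomposition_of_even (hn : 5 ≤ n) (heven : Even n)
    (hu : HasCirculantSupports u) (hA : A ∈ copositiveFace u) (hexc : IsExceptional A)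
    (hmem : A ∈ matrixSpace u) (hcorank : formCorank (formOfMatrix hn hu ⟨A, hmem⟩) = 0) :
    ∃ A' P : Matrix (Fin n) (Fin n) ℝ,
      HasNonMinimalCirculantZeroSupport A' ∧ P.PosSemidef ∧ P.rank = 1 ∧ A = A' + P := by
  have hB := isPosDefForm_of_formCorank_eq_zero hn hu hA hmem hcorank
  obtain ⟨y, hy, hyu⟩ := exists_dotProduct_eq_zero_of_hasEigenvalue_one hu
    (hasEigenvalue_monodromy_one hn heven hu hB)
  obtain ⟨t, ht, hface, hexc', hcorank'⟩ := hexc.exists_sub_smul_vecMulVec hn hu hA hy hyu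
  have hmem' := mem_matrixSpace_of_mem_copositiveFace (by omega) hu hface
  have ht0 : t ≠ 0 := by
    rintro rfl
    have hone := hcorank' hmem'
    simp only [zero_smul, sub_zero, hcorank, zero_ne_one] at hone
  refine ⟨A - t • vecMulVec y y, t • vecMulVec y y,
    hexc'.hasNonMinimalCirculantZeroSupport hn hu hface (t := 0) ?_, ?_, ?_,
    (sub_add_cancel _ _).symm⟩
  · rw [finrank_arcKernel hn hu ⟨_, hmem'⟩ 0, hcorank' hmem']
  · exact PosSemidef.smul (by simpa using posSemidef_vecMulVec_self_star y) ht
  · rw [← smul_vecMulVec]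
    exact rank_vecMulVec_eq_one (smul_ne_zero ht0 hy) hy

theorem IsExceptional.exists_eq_smul (hn : 5 ≤ n) (hu : HasCirculantSupports u)
    (hA : A ∈ copositiveFace u) (hexc : IsExceptional A)
    (hrank : ∀ j, Module.finrank ℝ (arcKernel A j) = 1)
    {v : Fin n → ℝ} (hv : IsZeroOf A v) :
    ∃ (j : Fin n) (c : ℝ), 0 < c ∧ v = c • u j := by
  obtain ⟨j, hvj⟩ := hexc.exists_support_subset_arcSet hn hu hA hv
  exact ⟨j, hv.exists_eq_smul (by omega) hu hA (hrank j) hvj⟩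

theorem IsExceptional.isMinimalZeroOf_iff (hn : 5 ≤ n) (hu : HasCirculantSupports u)
    (hA : A ∈ copositiveFace u) (hexc : IsExceptional A)
    (hrank : ∀ j, Module.finrank ℝ (arcKernel A j) = 1) {v : Fin n → ℝ} :
    IsMinimalZeroOf A v ↔ ∃ (j : Fin n) (c : ℝ), 0 < c ∧ v = c • u j := by
  refine ⟨fun hv => hexc.exists_eq_smul hn hu hA hrank hv.1, ?_⟩
  rintro ⟨j, c, hc, rfl⟩
  refine ⟨(isZeroOf_of_mem_copositiveFace (by omega) hu hA j).smul hc, ?_⟩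
  rintro ⟨w, hw, hsub⟩
  rw [support_smul_eq_arcSet hu j hc.ne'] at hsub
  obtain ⟨d, hd, rfl⟩ := hw.exists_eq_smul (by omega) hu hA (hrank j) hsub.1
  exact hsub.ne (support_smul_eq_arcSet hu j hd.ne')

theorem IsExceptional.minimalZeroSupports_eq_range (hn : 5 ≤ n) (hu : HasCirculantSupports u)
    (hA : A ∈ copositiveFace u) (hexc : IsExceptional A)
    (hrank : ∀ j, Module.finrank ℝ (arcKernel A j) = 1) :
    minimalZeroSupports A = Set.range (arcSet n) := by
  ext S
  constructor
  · rintro ⟨v, hv, rfl⟩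
    obtain ⟨j, c, hc, rfl⟩ := (hexc.isMinimalZeroOf_iff hn hu hA hrank).1 hv
    exact ⟨j, (support_smul_eq_arcSet hu j hc.ne').symm⟩
  · rintro ⟨j, rfl⟩
    exact ⟨u j, (hexc.isMinimalZeroOf_iff hn hu hA hrank).2 ⟨j, 1, one_pos, (one_smul ℝ _).symm⟩,
      (hu j).2⟩

theorem minimalCase_of_formCorank_eq_zero (hn : 5 ≤ n) (hu : HasCirculantSupports u)
    (hA : A ∈ copositiveFace u) (hexc : IsExceptional A) (hmem : A ∈ matrixSpace u)
    (hcorank : formCorank (formOfMatrix hn hu ⟨A, hmem⟩) = 0) :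
    MinimalCase u A (formOfMatrix hn hu ⟨A, hmem⟩) := by
  have hB := isPosDefForm_of_formCorank_eq_zero hn hu hA hmem hcorank
  have hrank (j : Fin n) : Module.finrank ℝ (arcKernel A j) = 1 := by
    rw [← Fin.ofNat_val_eq_self j, finrank_arcKernel hn hu ⟨A, hmem⟩ j, hcorank]
  exact
    { minimal_support := ⟨hexc, u, hu, isZeroOf_of_mem_copositiveFace (by omega) hu hA,
        fun v hv =>
          let ⟨j, c, _, hv_eq⟩ := hexc.exists_eq_smul hn hu hA hrank hv
          ⟨j, c, hv_eq⟩⟩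
      posDef := hB
      corank_submatrix := fun j => (matrixCorank_arcSubmatrix A j).trans (hrank j)
      minimal_zero_supports := hexc.minimalZeroSupports_eq_range hn hu hA hrank
      minimal_zeros := fun _ => hexc.isMinimalZeroOf_iff hn hu hA hrank
      even_decomposition := fun heven =>
        hexc.exists_decomposition_of_even hn heven hu hA hmem hcorank
      odd_extremal := fun hodd => hexc.isExtremalCopositive_of_odd hn hodd hu hA hmem hB }

theorem MinimalCase.not_nonMinimalCase
    {B B' : LinearMap.BilinForm ℝ (Module.Dual ℝ (solutionSpace u))} (h : MinimalCase u A B) :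
    ¬ NonMinimalCase u A B' := fun h' =>
  absurd ((h.corank_submatrix (Fin.ofNat n 0)).symm.trans (h'.corank_submatrix _)) (by decide)

end Cases

theorem mainTheorem3 (n : ℕ) [NeZero n] (hn : 5 ≤ n) (u : Fin n → Fin n → ℝ)
    (hu : HasCirculantSupports u) (A : Matrix (Fin n) (Fin n) ℝ)
    (hA : A ∈ copositiveFace u) (hexc : IsExceptional A) :
    ∃ hmem : A ∈ matrixSpace u,
      Xor (MinimalCase u A (formOfMatrix hn hu ⟨A, hmem⟩))
        (NonMinimalCase u A (formOfMatrix hn hu ⟨A, hmem⟩)) := by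
  have hmem := mem_matrixSpace_of_mem_copositiveFace (by omega) hu hA
  refine ⟨hmem, ?_⟩
  rcases Nat.le_one_iff_eq_zero_or_eq_one.1 (hexc.formCorank_le_one hn hu hA hmem) with
    hcorank | hcorank
  · have hminimal := minimalCase_of_formCorank_eq_zero hn hu hA hexc hmem hcorank
    exact Or.inl ⟨hminimal, hminimal.not_nonMinimalCase⟩
  · have hnonminimal := nonMinimalCase_of_formCorank_eq_one hn hu hA hexc hmem hcorank
    exact Or.inr ⟨hnonminimal, fun hminimal => hminimal.not_nonMinimalCase hnonminimal⟩
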